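/- Let $\mathbb{C}P^2$ carry the Fubini--Study metric. Let $M\subset\mathbb{C}$ be one of the following domains: $\mathbb{C}^*=\mathbb{C}\setminus\{0\}$, $\mathbf{D}^*=\{0<|z|<1\}$, or $\mathbf{D}_r=\{r<|z|<1/r\}$ with $0<r<1$. Let $f:M\to\mathbb{C}P^2$ be a smooth minimal Lagrangian immersion that is conformal with respect to the complex structure of $M$. Suppose that $f$ is rotationally equivariant, i.e. there is a (continuous) one-parameter group $R(t)$, $t\in\mathbb{R}$, of isometries of $\mathbb{C}P^2$ with $f(e^{it}z)=R(t)f(z)$ for all $z\in M$, $t\in\mathbb{R}$. Then there are conformal minimal Lagrangian immersions $\hat f:\mathbb{C}^*\to\mathbb{C}P^2$ and $\tilde f:\mathbb{C}\to\mathbb{C}P^2$ such that 1. $\hat f$ is rotationally equivariant and extends $f$, i.e. $\hat f|_M=f$; 2. $\tilde f$ is translationally equivariant, i.e. there is a (continuous) one-parameter group $\tilde R(t)$ of isometries of $\mathbb{C}P^2$ with $\tilde f(w+t)=\tilde R(t)\tilde f(w)$ for all $w\in\mathbb{C}$, $t\in\mathbb{R}$, and $\tilde f$ is $2\pi$-periodic,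 $\tilde f(w+2\pi)=\tilde f(w)$; 3. $\hat f$ is obtained from $\tilde f$ by projection along the covering $w\mapsto e^{iw}$ of $\mathbb{C}^*$, i.e. $\hat f(e^{iw})=\tilde f(w)$ for all $w\in\mathbb{C}$. -/

import Mathlib

open scoped ContDiff Topology LinearAlgebra.Projectivization

noncomputable section

/-- The Hermitian space `ℂ³`. -/
abbrev C3 : Type := EuclideanSpace ℂ (Fin 3)

/-- The complex projective plane. -/
abbrev CP2 : Type := ℙ ℂ C3

/-- The geodesic distance of the Fubini-Study metric (normalized so that `S⁵(1) → ℂP²` is a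
Riemannian submersion): `cos d([v], [w]) = |⟨v, w⟩| / (‖v‖ ‖w‖)`. -/
def fsDist (p q : CP2) : ℝ :=
  Real.arccos (‖inner ℂ p.rep q.rep‖ / (‖p.rep‖ * ‖q.rep‖))

/-- The distance can be computed with arbitrary representatives. -/
theorem fsDist_mk (v w : C3) (hv : v ≠ 0) (hw : w ≠ 0) :
    fsDist (Projectivization.mk ℂ v hv) (Projectivization.mk ℂ w hw) =
      Real.arccos (‖inner ℂ v w‖ / (‖v‖ * ‖w‖)) := by
  obtain ⟨a, ha⟩ := Projectivization.exists_smul_eq_mk_rep ℂ v hv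
  obtain ⟨b, hb⟩ := Projectivization.exists_smul_eq_mk_rep ℂ w hw
  have ha0 : ‖(a : ℂ)‖ ≠ 0 := by simp
  have hb0 : ‖(b : ℂ)‖ ≠ 0 := by simp
  have hv0 : ‖v‖ ≠ 0 := by simpa using hv
  have hw0 : ‖w‖ ≠ 0 := by simpa using hw
  rw [fsDist, ← ha, ← hb, Units.smul_def, Units.smul_def, inner_smul_left, inner_smul_right,
    norm_smul, norm_smul, norm_mul, norm_mul, RCLike.norm_conj]
  congr 1
  field_simp

/-- A (continuous) one-parameter group of isometries of `ℂP²`. -/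
structure IsOneParameterIsometryGroup (R : ℝ → Equiv.Perm CP2) : Prop where
  isometry : ∀ t p q, fsDist (R t p) (R t q) = fsDist p q
  add : ∀ s t, R (s + t) = R s * R t
  continuous : ∀ p s, Filter.Tendsto (fun t => fsDist (R t p) (R s p)) (𝓝 s) (𝓝 0)

/-! ### Maps into `ℂP²` in terms of local lifts to `ℂ³ \ {0}`

For `L = ℂ v` one has `T_L ℂP² = Hom(L, L^⊥)`.  Along a map with local lift `F`, a tangent vector
`σ ∈ Hom(L, L^⊥)` is represented by the vector `σ(F) ∈ F^⊥`. -/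

/-- `F` is a smooth lift of `f` to `ℂ³ \ {0}` on the open set `V`. -/
structure IsLocalLift (F : ℂ → C3) (f : ℂ → CP2) (V : Set ℂ) : Prop where
  isOpen : IsOpen V
  smooth : ContDiffOn ℝ ∞ F V
  lift : ∀ z ∈ V, ∃ h : F z ≠ 0, f z = Projectivization.mk ℂ (F z) h

/-- The coefficient of `v` in the orthogonal decomposition `ℂ³ = ℂ v ⊕ v^⊥` of `w`. -/
def lineCoeff (v w : C3) : ℂ := inner ℂ v w / inner ℂ v v

/-- The component of `w` in `v^⊥`. -/
def horPart (v w : C3) : C3 := w - lineCoeff v w • v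

/-- `df(X)`, represented by the projection of `∂_X F` to `F^⊥`. -/
def tangentVec (F : ℂ → C3) (X : ℂ) (z : ℂ) : C3 :=
  horPart (F z) (fderiv ℝ F z X)

/-- The pull-back under `f = [F]` of the Hermitian form of the Fubini-Study metric. -/
def fsHermitian (F : ℂ → C3) (z : ℂ) (X Y : ℂ) : ℂ :=
  inner ℂ (tangentVec F X z) (tangentVec F Y z) / ((‖F z‖ ^ 2 : ℝ) : ℂ)

/-- The pull-back of the Fubini-Study Riemannian metric. -/
def inducedMetric (F : ℂ → C3) (z : ℂ) (X Y : ℂ) : ℝ := (fsHermitian F z X Y).re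

/-- The pull-back of the Kähler form (up to sign convention). -/
def inducedKahlerForm (F : ℂ → C3) (z : ℂ) (X Y : ℂ) : ℝ := (fsHermitian F z X Y).im

/-- The Levi-Civita connection of the Fubini-Study metric, pulled back under `f = [F]`:  for a
section `σ` of `f^* TℂP² = Hom(L, L^⊥)` represented by `W = σ(F)`, where `L` and `L^⊥` carry the
connections obtained by projecting the flat connection of `ℂ³`,
`(∇_X σ)(F) = pr_{L^⊥} (∂_X W) - σ(pr_L (∂_X F))`. -/
def covDeriv (F : ℂ → C3) (W : ℂ → C3) (X : ℂ) (z : ℂ) : C3 :=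
  horPart (F z) (fderiv ℝ W z X) - lineCoeff (F z) (fderiv ℝ F z X) • W z

/-- `∇_X (df(Y))` for constant vector fields `X`, `Y` on the plane. Its normal component is the
second fundamental form. -/
def secondDeriv (F : ℂ → C3) (X Y : ℂ) (z : ℂ) : C3 :=
  covDeriv F (tangentVec F Y) X z

/-- `f = [F]` is an immersion at `z` which is conformal with respect to the complex structure of
the domain, that is, the induced metric is `2 e^u dz dz̄`. -/
def IsConformalImmersionAt (F : ℂ → C3) (z : ℂ) : Prop :=
  0 < inducedMetric F z 1 1 ∧
  inducedMetric F z 1 1 = inducedMetric F z Complex.I Complex.I ∧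
  inducedMetric F z 1 Complex.I = 0

/-- `f = [F]` is Lagrangian at `z`. -/
def IsLagrangianAt (F : ℂ → C3) (z : ℂ) : Prop :=
  ∀ X Y : ℂ, inducedKahlerForm F z X Y = 0

/-- `det g` times the trace, with respect to the induced metric `g`, of `∇ df`. The normal component
of this vector is `2 det g` times the mean curvature vector. -/
def metricTrace (F : ℂ → C3) (z : ℂ) : C3 :=
  inducedMetric F z Complex.I Complex.I • secondDeriv F 1 1 z
    - inducedMetric F z 1 Complex.I • secondDeriv F 1 Complex.I z
    - inducedMetric F z 1 Complex.I • secondDeriv F Complex.I 1 z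
    + inducedMetric F z 1 1 • secondDeriv F Complex.I Complex.I z

/-- The mean curvature vector of `f = [F]` vanishes at `z`: the metric trace of `∇ df` is orthogonal
to every normal vector `ν ∈ F^⊥`. -/
def IsMinimalAt (F : ℂ → C3) (z : ℂ) : Prop :=
  ∀ ν : C3, inner ℂ (F z) ν = 0 → (∀ X : ℂ, (inner ℂ (tangentVec F X z) ν).re = 0) →
    (inner ℂ (metricTrace F z) ν).re = 0

/-- `f` is a smooth conformal minimal Lagrangian immersion of the open set `U ⊆ ℂ` into `ℂP²`.
(The three pointwise conditions do not depend on the choice of the local lift.) -/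
def IsMinimalLagrangianImmersion (f : ℂ → CP2) (U : Set ℂ) : Prop :=
  ∀ p ∈ U, ∃ (V : Set ℂ) (F : ℂ → C3), p ∈ V ∧ V ⊆ U ∧ IsLocalLift F f V ∧
    ∀ z ∈ V, IsConformalImmersionAt F z ∧ IsLagrangianAt F z ∧ IsMinimalAt F z

/-- `f : U → ℂP²` is equivariant relative to the one-parameter group `(γ t, R t)`. -/
def IsEquivariant (f : ℂ → CP2) (U : Set ℂ) (γ : ℝ → ℂ → ℂ) (R : ℝ → Equiv.Perm CP2) : Prop :=
  IsOneParameterIsometryGroup R ∧ ∀ t, ∀ p ∈ U, γ t p ∈ U ∧ f (γ t p) = R t (f p)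

/-- Equivariance under the group of all rotations about the origin. -/
def IsRotationallyEquivariant (f : ℂ → CP2) (U : Set ℂ) : Prop :=
  ∃ R : ℝ → Equiv.Perm CP2, IsEquivariant f U (fun t z => Complex.exp (t * Complex.I) * z) R

/-- Equivariance under the group of all real translations. -/
def IsTranslationallyEquivariant (f : ℂ → CP2) (U : Set ℂ) : Prop :=
  ∃ R : ℝ → Equiv.Perm CP2, IsEquivariant f U (fun t z => z + t) R

/-- `ℂ^*`. -/
def puncturedPlane : Set ℂ := {z | z ≠ 0}

/-- `𝐃^*`. -/
def puncturedDisk : Set ℂ := {z | 0 < ‖z‖ ∧ ‖z‖ < 1}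

/-- `𝐃_r`, for `0 < r < 1`. -/
def openAnnulus (r : ℝ) : Set ℂ := {z | r < ‖z‖ ∧ ‖z‖ < 1 / r}

end

noncomputable section

/-! ### The conjugate cross product on `ℂ³` -/

/-! A minimal Lagrangian surface in `ℂP²` lifts locally to a special Legendrian surface in the unit
sphere of `ℂ³`: a unit lift `F` with `⟨F, dF⟩ = 0` and `F_y = F × F_x`, where `×` is the conjugate
cross product `jc`. The phase is fixed by the second equation, and minimality is exactly what then
makes the lift horizontal (`isSpecialAt_of_normalized`; the converse is `IsSpecialOn.isMinimalAt`).
Such a lift is unique up to a constant cube root of unity (`IsSpecialOn.eq_smul`), and `×` commutes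
with `SU(3)`. On the logarithmic cover `z = e^{iw}` the domain becomes a horizontal strip, a half
plane or the whole plane, hence convex, and rotations become real translations. Each isometry in a
continuous one-parameter group is induced by a special unitary map: Wigner's argument leaves only an
antiunitary ambiguity, excluded by continuity of the Bargmann invariant. Uniqueness of special lifts
turns this projective symmetry into `F(w + t) = U_t F(w)`, and differentiation in `t` yields a skew
generator `A` with `F_x = A F` (`IsSpecialOn.exists_generator`). Hence `F` solves `F_x = A F`, `F_y
= F × A F`. The second equation is an ordinary differential equation on the compact sphere, so its
solution `γ` exists for all times, and `Γ(x + iy) = exp(xA) γ(y)` is a special lift on the whole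
plane. ODE uniqueness and connectedness show that it covers the given map. Its translate by `2π` is
a constant multiple of it, so the projected map is `2π`-periodic and descends to `ℂ^*`. -/

theorem C3.inner_eq (a b : C3) :
    inner ℂ a b = star (a 0) * b 0 + star (a 1) * b 1 + star (a 2) * b 2 := by
  simp [PiLp.inner_apply, Fin.sum_univ_three, mul_comm]

theorem C3.ext_coord {a b : C3} (h0 : a 0 = b 0) (h1 : a 1 = b 1) (h2 : a 2 = b 2) : a = b := by
  ext i; fin_cases i <;> assumption

/-- The complex conjugate of the cross product of two vectors in `ℂ³`. -/
def jc (a b : C3) : C3 :=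
  WithLp.toLp 2 ![star (a 1 * b 2 - a 2 * b 1), star (a 2 * b 0 - a 0 * b 2),
    star (a 0 * b 1 - a 1 * b 0)]

@[simp] theorem jc_zero_coord (a b : C3) : jc a b 0 = star (a 1 * b 2 - a 2 * b 1) := rfl
@[simp] theorem jc_one_coord (a b : C3) : jc a b 1 = star (a 2 * b 0 - a 0 * b 2) := rfl
@[simp] theorem jc_two_coord (a b : C3) : jc a b 2 = star (a 0 * b 1 - a 1 * b 0) := rfl

theorem jc_swap (a b : C3) : jc a b = -jc b a := by
  apply C3.ext_coord <;> simp <;> ring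

@[simp] theorem jc_self (a : C3) : jc a a = 0 := by
  apply C3.ext_coord <;> simp [mul_comm]

theorem jc_add_left (a b c : C3) : jc (a + b) c = jc a c + jc b c := by
  apply C3.ext_coord <;> simp <;> ring

theorem jc_add_right (a b c : C3) : jc a (b + c) = jc a b + jc a c := by
  apply C3.ext_coord <;> simp <;> ring

theorem jc_smul_left (k : ℂ) (a b : C3) : jc (k • a) b = star k • jc a b := by
  apply C3.ext_coord <;> simp <;> ring

theorem jc_smul_right (k : ℂ) (a b : C3) : jc a (k • b) = star k • jc a b := by
  apply C3.ext_coord <;> simp <;> ring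

theorem jc_real_smul_left (k : ℝ) (a b : C3) : jc (k • a) b = k • jc a b := by
  apply C3.ext_coord <;> simp <;> ring

theorem jc_real_smul_right (k : ℝ) (a b : C3) : jc a (k • b) = k • jc a b := by
  apply C3.ext_coord <;> simp <;> ring

theorem inner_jc_left (a b : C3) : inner ℂ a (jc a b) = 0 := by
  simp [C3.inner_eq]; ring

theorem inner_jc_right (a b : C3) : inner ℂ b (jc a b) = 0 := by
  simp [C3.inner_eq]; ring

/-- The triple product expansion; conjugation is what makes Hermitian products appear. For a unit
vector `a` it says that `jc a` squares to `-1` on the orthogonal complement of `a`, so it plays the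
role of rotation by a right angle in the tangent plane. -/
theorem jc_jc (a b c : C3) : jc a (jc b c) = inner ℂ a c • b - inner ℂ a b • c := by
  apply C3.ext_coord <;> simp [C3.inner_eq] <;> ring

theorem inner_jc_jc (a b c d : C3) :
    inner ℂ (jc a b) (jc c d) = inner ℂ c a * inner ℂ d b - inner ℂ c b * inner ℂ d a := by
  simp [C3.inner_eq]; ring

/-- By Lagrange's identity the defect of the squares is `|⟨a, b⟩|²`. -/
theorem norm_jc_le (a b : C3) : ‖jc a b‖ ≤ ‖a‖ * ‖b‖ := by
  have h := inner_jc_jc a b a b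
  rw [← inner_conj_symm b a, inner_self_eq_norm_sq_to_K, inner_self_eq_norm_sq_to_K,
    inner_self_eq_norm_sq_to_K, Complex.mul_conj] at h
  have h' : ‖jc a b‖ ^ 2 = ‖a‖ ^ 2 * ‖b‖ ^ 2 - Complex.normSq (inner ℂ a b) := by
    apply Complex.ofReal_injective
    push_cast
    simpa using h
  have := Complex.normSq_nonneg (inner ℂ a b)
  apply le_of_sq_le_sq _ (by positivity)
  rw [h', mul_pow]; linarith

/-- `jc` as a continuous real bilinear map. -/
def jcL : C3 →L[ℝ] C3 →L[ℝ] C3 :=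
  LinearMap.mkContinuous₂
    (LinearMap.mk₂ ℝ jc jc_add_left jc_real_smul_left jc_add_right jc_real_smul_right) 1
    (fun a b => by simpa using norm_jc_le a b)

@[simp] theorem jcL_apply (a b : C3) : jcL a b = jc a b := rfl

/-- A basis adapted to two orthogonal vectors. -/
theorem C3.expand {a b : C3} (ha : ‖a‖ = 1) (hb : b ≠ 0) (hab : inner ℂ a b = 0) (v : C3) :
    v = inner ℂ a v • a + (inner ℂ b v / (‖b‖ ^ 2 : ℝ)) • b
      + (inner ℂ (jc a b) v / (‖b‖ ^ 2 : ℝ)) • jc a b := by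
  have hb' : (‖b‖ : ℂ) ≠ 0 := by simpa using hb
  have haa : inner ℂ a a = 1 := by rw [inner_self_eq_norm_sq_to_K, ha]; simp
  have hbb : inner ℂ b b = (‖b‖ : ℂ) ^ 2 := inner_self_eq_norm_sq_to_K b
  -- The double product of `jc a b` with `v` is evaluated in two ways: directly by `jc_jc`, and
  -- through `h2`, `h3`, `h4`. Solving for `‖b‖² v` gives the expansion.
  have h1 : jc (jc a b) (jc (jc a b) v) = inner ℂ (jc a b) v • jc a b
      - (‖b‖ : ℂ) ^ 2 • v := by
    rw [jc_jc, inner_jc_jc, haa, hbb, hab]; simp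
  have h2 : jc (jc a b) v = inner ℂ v a • b - inner ℂ v b • a := by
    rw [jc_swap, jc_jc]; abel
  have h3 : jc (jc a b) a = b := by
    rw [jc_swap, jc_jc, haa, hab]; simp
  have h4 : jc (jc a b) b = -((‖b‖ : ℂ) ^ 2 • a) := by
    rw [jc_swap, jc_jc, hbb, ← inner_conj_symm, hab]; simp
  rw [h2, sub_eq_add_neg, jc_add_right, ← neg_smul, jc_smul_right, jc_smul_right, h3, h4] at h1
  simp only [star_neg, RCLike.star_def, inner_conj_symm] at h1
  have h5 : v = ((‖b‖ : ℂ) ^ 2)⁻¹ • ((‖b‖ : ℂ) ^ 2 • v) := by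
    rw [smul_smul, inv_mul_cancel₀ (by positivity), one_smul]
  have h6 : (‖b‖ : ℂ) ^ 2 • v = inner ℂ (jc a b) v • jc a b + inner ℂ b v • b
      + (inner ℂ a v * (‖b‖ : ℂ) ^ 2) • a := by
    have hW : (‖b‖ : ℂ) ^ 2 • v = inner ℂ (jc a b) v • jc a b
        - (inner ℂ a v • -((‖b‖ : ℂ) ^ 2 • a) + -inner ℂ b v • b) := by
      rw [h1]; abel
    rw [hW]; module
  conv_lhs => rw [h5, h6]
  push_cast
  match_scalars <;> field_simp

theorem norm_jc_of_inner_eq_zero {a b : C3} (hab : inner ℂ a b = 0) :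
    ‖jc a b‖ = ‖a‖ * ‖b‖ := by
  have h := inner_jc_jc a b a b
  rw [hab, inner_self_eq_norm_sq_to_K, inner_self_eq_norm_sq_to_K,
    inner_self_eq_norm_sq_to_K, zero_mul, sub_zero] at h
  have h' : ‖jc a b‖ ^ 2 = (‖a‖ * ‖b‖) ^ 2 := by
    apply Complex.ofReal_injective
    push_cast
    rw [mul_pow]
    simpa using h
  exact (sq_eq_sq₀ (by positivity) (by positivity)).1 h'

/-! ### Special unitary maps -/

/-- A linear endomorphism of `ℂ³` preserving the inner product and the conjugate cross product. -/
structure IsSU (U : C3 →L[ℂ] C3) : Prop where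
  inner_map : ∀ a b, inner ℂ (U a) (U b) = inner ℂ a b
  map_jc : ∀ a b, U (jc a b) = jc (U a) (U b)

namespace IsSU

theorem norm_map {U : C3 →L[ℂ] C3} (hU : IsSU U) (a : C3) : ‖U a‖ = ‖a‖ := by
  rw [@norm_eq_sqrt_re_inner ℂ, @norm_eq_sqrt_re_inner ℂ, hU.inner_map]

theorem map_ne_zero {U : C3 →L[ℂ] C3} (hU : IsSU U) {a : C3} (ha : a ≠ 0) : U a ≠ 0 := by
  rw [← norm_ne_zero_iff, hU.norm_map]; simpa using ha

/-- Since `jc` is antilinear in both arguments, commuting with it requires `k = k̄²`, that is `k³ =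
1` for unit `k`: the scalars in `SU(3)`. -/
theorem smul {U : C3 →L[ℂ] C3} (hU : IsSU U) {k : ℂ} (hk : ‖k‖ = 1) (hk3 : k ^ 3 = 1) :
    IsSU (k • U) := by
  have hkk : star k * k = 1 := by
    simp [RCLike.star_def, mul_comm, Complex.mul_conj, Complex.normSq_eq_norm_sq, hk]
  refine ⟨fun a b => ?_, fun a b => ?_⟩
  · simp only [_root_.smul_apply, inner_smul_left, inner_smul_right, hU.inner_map,
      ← mul_assoc, ← RCLike.star_def]
    rw [mul_comm k, hkk, one_mul]
  · simp only [_root_.smul_apply, hU.map_jc, jc_smul_left, jc_smul_right, smul_smul]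
    congr 1
    linear_combination star k ^ 2 * hk3 - k * (k * star k + 1) * hkk

end IsSU

/-- A unitary matrix becomes special after multiplication by a suitable scalar, which does not
change its action on `ℂP²`. -/
theorem exists_isSU_of_orthonormal {f₀ f₁ f₂ : C3} (n0 : ‖f₀‖ = 1) (n1 : ‖f₁‖ = 1) (n2 : ‖f₂‖ = 1)
    (h01 : inner ℂ f₀ f₁ = 0) (h02 : inner ℂ f₀ f₂ = 0) (h12 : inner ℂ f₁ f₂ = 0) :
    ∃ (U : C3 →L[ℂ] C3) (μ : ℂ), ‖μ‖ = 1 ∧ IsSU U ∧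
      ∀ v, U v = μ • (v 0 • f₀ + v 1 • f₁ + v 2 • f₂) := by
  have key : ∃ μ : ℂ, ‖μ‖ = 1 ∧ jc (μ • f₀) (μ • f₁) = μ • f₂ := by
    set κ := inner ℂ (jc f₀ f₁) f₂ with hκ
    have h1 : f₂ = κ • jc f₀ f₁ := by
      have := C3.expand n0 (by rw [← norm_ne_zero_iff, n1]; simp) h01 f₂
      rw [h02, h12, n1, ← hκ] at this
      simpa using this
    have nκ : ‖κ‖ = 1 := by
      have := congrArg norm h1
      rw [norm_smul, norm_jc_of_inner_eq_zero h01, n0, n1, n2] at this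
      simpa using this.symm
    -- The required relation is `μ̄² = μ κ`, which for `|μ| = 1` means `μ³ = κ̄`.
    obtain ⟨μ, hμ⟩ := IsAlgClosed.exists_pow_nat_eq (star κ) (n := 3) (by norm_num)
    have nμ : ‖μ‖ = 1 := by
      have := congrArg norm hμ
      rw [norm_pow, norm_star, nκ] at this
      exact (pow_eq_one_iff_of_nonneg (norm_nonneg _) (by norm_num)).1 this
    refine ⟨μ, nμ, ?_⟩
    rw [h1, jc_smul_left, jc_smul_right, smul_smul, smul_smul]
    congr 1
    have hμμ : star μ * μ = 1 := by
      simp [RCLike.star_def, mul_comm, Complex.mul_conj, Complex.normSq_eq_norm_sq, nμ]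
    have hκ' : κ = star μ ^ 3 := by rw [← star_pow, hμ, star_star]
    rw [hκ']
    linear_combination (-star μ ^ 2) * hμμ
  obtain ⟨μ, nμ, hμ⟩ := key
  have hμμ : (starRingEnd ℂ) μ * μ = 1 := by
    simp [mul_comm, Complex.mul_conj, Complex.normSq_eq_norm_sq, nμ]
  set g₀ := μ • f₀ with hg0
  set g₁ := μ • f₁ with hg1
  set g₂ := μ • f₂ with hg2
  have self1 : ∀ f : C3, ‖f‖ = 1 → inner ℂ (μ • f) (μ • f) = 1 := fun f hf => by
    rw [inner_self_eq_norm_sq_to_K, norm_smul, nμ, hf]; simp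
  have i00 : inner ℂ g₀ g₀ = 1 := self1 _ n0
  have i11 : inner ℂ g₁ g₁ = 1 := self1 _ n1
  have i22 : inner ℂ g₂ g₂ = 1 := self1 _ n2
  have i01 : inner ℂ g₀ g₁ = 0 := by simp [hg0, hg1, h01]
  have i02 : inner ℂ g₀ g₂ = 0 := by simp [hg0, hg2, h02]
  have i12 : inner ℂ g₁ g₂ = 0 := by simp [hg1, hg2, h12]
  have i10 : inner ℂ g₁ g₀ = 0 := by rw [← inner_conj_symm, i01, map_zero]
  have i20 : inner ℂ g₂ g₀ = 0 := by rw [← inner_conj_symm, i02, map_zero]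
  have i21 : inner ℂ g₂ g₁ = 0 := by rw [← inner_conj_symm, i12, map_zero]
  have j12 : jc g₁ g₂ = g₀ := by rw [← hμ, jc_jc, i11, i10]; simp
  have j02 : jc g₀ g₂ = -g₁ := by rw [← hμ, jc_jc, i01, i00]; simp
  have j10 : jc g₁ g₀ = -g₂ := by rw [jc_swap, hμ]
  have j21 : jc g₂ g₁ = -g₀ := by rw [jc_swap, j12]
  have j20 : jc g₂ g₀ = g₁ := by rw [jc_swap, j02, neg_neg]
  let U : C3 →L[ℂ] C3 :=
    (EuclideanSpace.proj (𝕜 := ℂ) (0 : Fin 3)).smulRight g₀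
      + (EuclideanSpace.proj (𝕜 := ℂ) (1 : Fin 3)).smulRight g₁
      + (EuclideanSpace.proj (𝕜 := ℂ) (2 : Fin 3)).smulRight g₂
  have hU : ∀ v, U v = v 0 • g₀ + v 1 • g₁ + v 2 • g₂ := fun v => rfl
  refine ⟨U, μ, nμ, ⟨fun a b => ?_, fun a b => ?_⟩, fun v => ?_⟩
  · simp only [hU, inner_add_left, inner_add_right, inner_smul_left, inner_smul_right, i00, i11,
      i22, i01, i02, i12, i10, i20, i21, C3.inner_eq a b, RCLike.star_def]
    ring
  · simp only [hU, jc_add_left, jc_add_right, jc_smul_left, jc_smul_right, jc_self, hμ, j12, j02,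
      j10, j21, j20, jc_zero_coord, jc_one_coord, jc_two_coord, star_sub, star_mul]
    module
  · rw [hU, hg0, hg1, hg2]; module

/-! ### Representatives of points of `ℂP²` -/

/-- `v` is a nonzero vector on the line `p`. -/
def IsRep (v : C3) (p : CP2) : Prop := ∃ h : v ≠ 0, p = Projectivization.mk ℂ v h

namespace IsRep

theorem ne_zero {v : C3} {p : CP2} (h : IsRep v p) : v ≠ 0 := h.1

theorem smul {v : C3} {p : CP2} (h : IsRep v p) {c : ℂ} (hc : c ≠ 0) : IsRep (c • v) p := by
  obtain ⟨hv, rfl⟩ := h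
  refine ⟨smul_ne_zero hc hv, ?_⟩
  rw [Projectivization.mk_eq_mk_iff']
  exact ⟨c⁻¹, by rw [smul_smul, inv_mul_cancel₀ hc, one_smul]⟩

theorem exists_smul {v w : C3} {p : CP2} (hv : IsRep v p) (hw : IsRep w p) :
    ∃ c : ℂ, c ≠ 0 ∧ v = c • w := by
  obtain ⟨hv0, rfl⟩ := hv
  obtain ⟨hw0, h⟩ := hw
  obtain ⟨c, hc⟩ := (Projectivization.mk_eq_mk_iff' ℂ v w hv0 hw0).1 h
  exact ⟨c, fun h0 => hv0 (by rw [← hc, h0, zero_smul]), hc.symm⟩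

theorem unique {v : C3} {p q : CP2} (hp : IsRep v p) (hq : IsRep v q) : p = q := by
  obtain ⟨_, rfl⟩ := hp
  obtain ⟨_, rfl⟩ := hq
  rfl

theorem mk {v : C3} (hv : v ≠ 0) : IsRep v (Projectivization.mk ℂ v hv) := ⟨hv, rfl⟩

theorem rep (p : CP2) : IsRep p.rep p := ⟨p.rep_nonzero, p.mk_rep.symm⟩

theorem exists_unit (p : CP2) : ∃ v, ‖v‖ = 1 ∧ IsRep v p := by
  have h : (‖p.rep‖ : ℂ)⁻¹ ≠ 0 := by simpa using p.rep_nonzero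
  refine ⟨(‖p.rep‖ : ℂ)⁻¹ • p.rep, ?_, (rep p).smul h⟩
  rw [norm_smul, norm_inv, Complex.norm_real, norm_norm, inv_mul_cancel₀]
  simpa using p.rep_nonzero

theorem cos_fsDist {v w : C3} {p q : CP2} (hv : IsRep v p) (hw : IsRep w q) :
    Real.cos (fsDist p q) = ‖inner ℂ v w‖ / (‖v‖ * ‖w‖) := by
  obtain ⟨hv0, rfl⟩ := hv
  obtain ⟨hw0, rfl⟩ := hw
  rw [fsDist_mk, Real.cos_arccos]
  · have : 0 ≤ ‖inner ℂ v w‖ / (‖v‖ * ‖w‖) := by positivity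
    linarith
  · exact div_le_one_of_le₀ (norm_inner_le_norm v w) (by positivity)

theorem norm_inner_eq {T : Equiv.Perm CP2} (hT : ∀ p q, fsDist (T p) (T q) = fsDist p q)
    {v w v' w' : C3} {p q : CP2} (hv : IsRep v p) (hw : IsRep w q) (hv' : IsRep v' (T p))
    (hw' : IsRep w' (T q)) :
    ‖inner ℂ v' w'‖ * (‖v‖ * ‖w‖) = ‖inner ℂ v w‖ * (‖v'‖ * ‖w'‖) := by
  have h := hT p q
  have h' := congrArg Real.cos h
  rw [hv'.cos_fsDist hw', hv.cos_fsDist hw] at h'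
  have := norm_ne_zero_iff.2 hv.ne_zero
  have := norm_ne_zero_iff.2 hw.ne_zero
  have := norm_ne_zero_iff.2 hv'.ne_zero
  have := norm_ne_zero_iff.2 hw'.ne_zero
  field_simp at h'
  linarith

end IsRep

/-! ### The Bargmann invariant of three points -/

/-- The Bargmann invariant of three points of the complex projective plane. -/
def bargmann (p q r : CP2) : ℂ :=
  inner ℂ p.rep q.rep * inner ℂ q.rep r.rep * inner ℂ r.rep p.rep /
    ((‖p.rep‖ ^ 2 * ‖q.rep‖ ^ 2 * ‖r.rep‖ ^ 2 : ℝ) : ℂ)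

/-- In the cyclic product each vector occurs once linearly and once antilinearly, so the choice of
representatives cancels against the norms. -/
theorem bargmann_eq {u v w : C3} {p q r : CP2} (hu : IsRep u p) (hv : IsRep v q)
    (hw : IsRep w r) :
    bargmann p q r = inner ℂ u v * inner ℂ v w * inner ℂ w u /
      ((‖u‖ ^ 2 * ‖v‖ ^ 2 * ‖w‖ ^ 2 : ℝ) : ℂ) := by
  obtain ⟨a, ha, rfl⟩ := hu.exists_smul (IsRep.rep p)
  obtain ⟨b, hb, rfl⟩ := hv.exists_smul (IsRep.rep q)
  obtain ⟨c, hc, rfl⟩ := hw.exists_smul (IsRep.rep r)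
  have ha' : (starRingEnd ℂ) a ≠ 0 := by simpa using ha
  have hb' : (starRingEnd ℂ) b ≠ 0 := by simpa using hb
  have hc' : (starRingEnd ℂ) c ≠ 0 := by simpa using hc
  have np : (‖p.rep‖ : ℂ) ≠ 0 := by simpa using p.rep_nonzero
  have nq : (‖q.rep‖ : ℂ) ≠ 0 := by simpa using q.rep_nonzero
  have nr : (‖r.rep‖ : ℂ) ≠ 0 := by simpa using r.rep_nonzero
  simp only [bargmann, inner_smul_left, inner_smul_right, norm_smul, Complex.ofReal_mul,
    Complex.ofReal_pow, mul_pow, ← Complex.mul_conj']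
  field_simp

namespace IsOneParameterIsometryGroup

variable {R : ℝ → Equiv.Perm CP2}

theorem map_zero (hR : IsOneParameterIsometryGroup R) : R 0 = 1 := by
  have h := hR.add 0 0
  rw [add_zero] at h
  exact left_eq_mul.1 h

/-- Unit representatives are rotated so that their product with a fixed representative at time `s`
is real and nonnegative. Then `‖v t - v s‖² = 2 - 2 cos d`, so convergence of points gives
convergence of vectors. -/
theorem exists_tendsto_rep (hR : IsOneParameterIsometryGroup R) (p : CP2) (s : ℝ) :
    ∃ v : ℝ → C3, (∀ t, ‖v t‖ = 1) ∧ (∀ t, IsRep (v t) (R t p)) ∧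
      Filter.Tendsto v (𝓝 s) (𝓝 (v s)) := by
  choose u hu1 hu using fun t => IsRep.exists_unit (R t p)
  have key : ∀ t, ∃ v, ‖v‖ = 1 ∧ IsRep v (R t p) ∧ inner ℂ v (u s) = (‖inner ℂ (u t) (u s)‖ : ℂ) := by
    intro t
    by_cases h : inner ℂ (u t) (u s) = 0
    · exact ⟨u t, hu1 t, hu t, by simp [h]⟩
    · have hn : (‖inner ℂ (u t) (u s)‖ : ℂ) ≠ 0 := by simpa using h
      refine ⟨(inner ℂ (u t) (u s) / ‖inner ℂ (u t) (u s)‖) • u t, ?_, (hu t).smul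
        (div_ne_zero h hn), ?_⟩
      · rw [norm_smul, hu1, norm_div, Complex.norm_real, norm_norm, mul_one, div_self]
        simpa using h
      · rw [inner_smul_left, map_div₀, Complex.conj_ofReal, div_mul_eq_mul_div, div_eq_iff hn,
          Complex.conj_mul', sq]
  choose v hv1 hv hin using key
  have hvs : v s = u s := by
    have h1 : inner ℂ (v s) (u s) = 1 := by
      rw [hin, inner_self_eq_norm_sq_to_K, hu1]; simp
    have := (inner_eq_one_iff_of_norm_eq_one (𝕜 := ℂ) (hv1 s) (hu1 s)).1 h1
    exact this
  have hsq : ∀ t, ‖v t - v s‖ ^ 2 = 2 - 2 * Real.cos (fsDist (R t p) (R s p)) := by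
    intro t
    rw [(hu t).cos_fsDist (hu s), hu1, hu1, hvs, @norm_sub_sq ℂ, hin, hv1, hu1]
    simp; ring
  refine ⟨v, hv1, hv, ?_⟩
  rw [tendsto_iff_norm_sub_tendsto_zero]
  have h2 : Filter.Tendsto (fun t => ‖v t - v s‖ ^ 2) (𝓝 s) (𝓝 0) := by
    simp only [hsq]
    have := (Real.continuous_cos.tendsto 0).comp (hR.continuous p s)
    have h3 := (this.const_mul 2).const_sub 2
    simpa using h3
  have h4 := (Real.continuous_sqrt.tendsto 0).comp h2
  simpa [Function.comp_def] using h4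

theorem continuous_bargmann (hR : IsOneParameterIsometryGroup R) (p q r : CP2) :
    Continuous fun t => bargmann (R t p) (R t q) (R t r) := by
  rw [continuous_iff_continuousAt]
  intro s
  obtain ⟨u, hu1, hu, hut⟩ := hR.exists_tendsto_rep p s
  obtain ⟨v, hv1, hv, hvt⟩ := hR.exists_tendsto_rep q s
  obtain ⟨w, hw1, hw, hwt⟩ := hR.exists_tendsto_rep r s
  have : (fun t => bargmann (R t p) (R t q) (R t r)) =
      fun t => inner ℂ (u t) (v t) * inner ℂ (v t) (w t) * inner ℂ (w t) (u t) := by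
    funext t
    rw [bargmann_eq (hu t) (hv t) (hw t), hu1, hv1, hw1]; simp
  rw [this]
  exact ((hut.inner hvt).mul (hvt.inner hwt)).mul (hwt.inner hut)

end IsOneParameterIsometryGroup

/-! ### Wigner's theorem for one-parameter groups -/

/-- The standard basis of `ℂ³`. -/
def stdVec (k : Fin 3) : C3 := EuclideanSpace.single k 1

theorem inner_stdVec (k : Fin 3) (v : C3) : inner ℂ (stdVec k) v = v k := by
  simp [stdVec, EuclideanSpace.inner_single_left]

theorem norm_stdVec (k : Fin 3) : ‖stdVec k‖ = 1 := by simp [stdVec]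

theorem stdVec_ne_zero (k : Fin 3) : stdVec k ≠ 0 := by
  rw [← norm_ne_zero_iff, norm_stdVec]; simp

theorem stdVec_apply (k l : Fin 3) : stdVec k l = if l = k then 1 else 0 := by
  simp [stdVec]

theorem inner_stdVec_add (k : Fin 3) (v : C3) :
    inner ℂ (stdVec 0 + stdVec k) v = v 0 + v k := by
  rw [inner_add_left, inner_stdVec, inner_stdVec]

theorem norm_sq_stdVec_add {k : Fin 3} (hk : k ≠ 0) : ‖stdVec 0 + stdVec k‖ ^ 2 = 2 := by
  have h := inner_self_eq_norm_sq_to_K (𝕜 := ℂ) (stdVec 0 + stdVec k)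
  rw [inner_stdVec_add] at h
  simp [stdVec_apply, hk, hk.symm] at h
  apply Complex.ofReal_injective
  push_cast
  rw [← h]; norm_num

theorem stdVec_add_ne_zero {k : Fin 3} (hk : k ≠ 0) : stdVec 0 + stdVec k ≠ 0 := by
  intro h
  have := norm_sq_stdVec_add hk
  rw [h] at this
  simp at this

theorem IsSU.surjective {U : C3 →L[ℂ] C3} (hU : IsSU U) : Function.Surjective U := by
  have hinj : Function.Injective (U : C3 →ₗ[ℂ] C3) := by
    rw [← LinearMap.ker_eq_bot, LinearMap.ker_eq_bot']
    intro m hm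
    by_contra h
    exact hU.map_ne_zero h hm
  exact LinearMap.injective_iff_surjective.1 hinj

theorem IsSU.exists_isRep {U : C3 →L[ℂ] C3} (hU : IsSU U) (p : CP2) : ∃ w, IsRep (U w) p := by
  obtain ⟨w, hw⟩ := hU.surjective p.rep
  exact ⟨w, hw ▸ IsRep.rep p⟩

theorem exists_isSU_stdVec {T : Equiv.Perm CP2} (hT : ∀ p q, fsDist (T p) (T q) = fsDist p q) :
    ∃ U : C3 →L[ℂ] C3, IsSU U ∧
      ∀ k, IsRep (U (stdVec k)) (T (Projectivization.mk ℂ (stdVec k) (stdVec_ne_zero k))) := by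
  choose f hf1 hf using fun k =>
    IsRep.exists_unit (T (Projectivization.mk ℂ (stdVec k) (stdVec_ne_zero k)))
  have horth : ∀ k l, k ≠ l → inner ℂ (f k) (f l) = 0 := by
    intro k l hkl
    have h := IsRep.norm_inner_eq hT (IsRep.mk (stdVec_ne_zero k)) (IsRep.mk (stdVec_ne_zero l))
      (hf k) (hf l)
    rw [inner_stdVec, norm_stdVec, norm_stdVec, hf1, hf1, stdVec_apply, if_neg hkl] at h
    simpa using h
  obtain ⟨U, μ, hμ, hU, hUv⟩ := exists_isSU_of_orthonormal (hf1 0) (hf1 1) (hf1 2)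
    (horth 0 1 (by decide)) (horth 0 2 (by decide)) (horth 1 2 (by decide))
  have hμ0 : μ ≠ 0 := by rw [← norm_ne_zero_iff, hμ]; simp
  refine ⟨U, hU, fun k => ?_⟩
  have : U (stdVec k) = μ • f k := by
    rw [hUv]; fin_cases k <;> simp [stdVec_apply]
  rw [this]
  exact (hf k).smul hμ0

/-- `U` realizes `T` on the three coordinate points and on the points `[e₀ + eₖ]`. -/
structure AgreesOnFrame (U : C3 →L[ℂ] C3) (T : Equiv.Perm CP2) : Prop where
  isSU : IsSU U
  map_stdVec : ∀ k, IsRep (U (stdVec k)) (T (Projectivization.mk ℂ (stdVec k) (stdVec_ne_zero k)))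
  map_stdVec_add : ∀ k (hk : k ≠ 0), IsRep (U (stdVec 0 + stdVec k))
    (T (Projectivization.mk ℂ (stdVec 0 + stdVec k) (stdVec_add_ne_zero hk)))

/-- Distances to the coordinate points force the image of `[e₀ + eₖ]` to be `[U(e₀ + α eₖ)]` with
`|α| = 1`. Absorbing these two phases into the columns of `U` corrects it on `[e₀ + e₁]` and `[e₀ +
e₂]` without moving the coordinate points. -/
theorem exists_agreesOnFrame {T : Equiv.Perm CP2}
    (hT : ∀ p q, fsDist (T p) (T q) = fsDist p q) : ∃ U, AgreesOnFrame U T := by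
  obtain ⟨U, hU, hUk⟩ := exists_isSU_stdVec hT
  have key : ∀ k : Fin 3, k ≠ 0 → ∃ α : ℂ, ‖α‖ = 1 ∧ ∀ hk : k ≠ 0,
      IsRep (U (stdVec 0 + α • stdVec k))
        (T (Projectivization.mk ℂ (stdVec 0 + stdVec k) (stdVec_add_ne_zero hk))) := by
    intro k hk
    obtain ⟨w, hw⟩ := hU.exists_isRep
      (T (Projectivization.mk ℂ (stdVec 0 + stdVec k) (stdVec_add_ne_zero hk)))
    have hl : ∀ l, ‖w l‖ * ‖stdVec 0 + stdVec k‖ = ‖(stdVec 0 + stdVec k) l‖ * ‖w‖ := by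
      intro l
      have h := IsRep.norm_inner_eq hT (IsRep.mk (stdVec_ne_zero l))
        (IsRep.mk (stdVec_add_ne_zero hk)) (hUk l) hw
      rwa [hU.inner_map, inner_stdVec, inner_stdVec, hU.norm_map, hU.norm_map, norm_stdVec,
        one_mul, one_mul] at h
    have hw0 : w ≠ 0 := fun h => hw.ne_zero (by rw [h, map_zero])
    have hnw := norm_ne_zero_iff.2 hw0
    have hne := norm_ne_zero_iff.2 (stdVec_add_ne_zero hk)
    have c0 : (stdVec 0 + stdVec k) 0 = 1 := by simp [stdVec_apply, hk.symm]
    have ck : (stdVec 0 + stdVec k) k = 1 := by simp [stdVec_apply, hk]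
    have h0 := hl 0
    have h1 := hl k
    rw [c0, norm_one, one_mul] at h0
    rw [ck, norm_one, one_mul] at h1
    have hw00 : w 0 ≠ 0 := by
      intro h
      rw [h, norm_zero, zero_mul] at h0
      exact hnw h0.symm
    have heq : ‖w k‖ = ‖w 0‖ := mul_right_cancel₀ hne (h1.trans h0.symm)
    refine ⟨w k / w 0, by rw [norm_div, heq, div_self (norm_ne_zero_iff.2 hw00)], fun _ => ?_⟩
    have hww : stdVec 0 + (w k / w 0) • stdVec k = (w 0)⁻¹ • w := by
      have hz : ∀ l, l ≠ 0 → l ≠ k → w l = 0 := by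
        intro l hl0 hlk
        have := hl l
        have cl : (stdVec 0 + stdVec k) l = 0 := by simp [stdVec_apply, hl0, hlk]
        rw [cl, norm_zero, zero_mul] at this
        simpa [hne] using this
      ext l
      by_cases hl0 : l = 0
      · subst hl0
        simp [stdVec_apply, hk.symm, hw00]
      · by_cases hlk : l = k
        · subst hlk
          simp [stdVec_apply, hl0, div_eq_inv_mul]
        · simp [stdVec_apply, hl0, hlk, hz l hl0 hlk]
    rw [hww, map_smul]
    exact hw.smul (inv_ne_zero hw00)
  obtain ⟨α, hα, hα'⟩ := key 1 (by decide)
  obtain ⟨β, hβ, hβ'⟩ := key 2 (by decide)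
  have hα0 : α ≠ 0 := by rw [← norm_ne_zero_iff, hα]; simp
  have hβ0 : β ≠ 0 := by rw [← norm_ne_zero_iff, hβ]; simp
  obtain ⟨V, μ, hμ, hV, hVv⟩ := exists_isSU_of_orthonormal (f₀ := U (stdVec 0))
    (f₁ := α • U (stdVec 1)) (f₂ := β • U (stdVec 2))
    (by rw [hU.norm_map, norm_stdVec]) (by rw [norm_smul, hα, hU.norm_map, norm_stdVec, one_mul])
    (by rw [norm_smul, hβ, hU.norm_map, norm_stdVec, one_mul])
    (by rw [inner_smul_right, hU.inner_map, inner_stdVec]; simp [stdVec_apply])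
    (by rw [inner_smul_right, hU.inner_map, inner_stdVec]; simp [stdVec_apply])
    (by rw [inner_smul_left, inner_smul_right, hU.inner_map, inner_stdVec]; simp [stdVec_apply])
  have hμ0 : μ ≠ 0 := by rw [← norm_ne_zero_iff, hμ]; simp
  refine ⟨V, hV, fun k => ?_, fun k hk => ?_⟩
  · fin_cases k
    · have : V (stdVec 0) = μ • U (stdVec 0) := by rw [hVv]; simp [stdVec_apply]
      exact this ▸ (hUk 0).smul hμ0
    · have : V (stdVec 1) = (μ * α) • U (stdVec 1) := by
        rw [hVv]; simp [stdVec_apply, smul_smul]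
      exact this ▸ (hUk 1).smul (mul_ne_zero hμ0 hα0)
    · have : V (stdVec 2) = (μ * β) • U (stdVec 2) := by
        rw [hVv]; simp [stdVec_apply, smul_smul]
      exact this ▸ (hUk 2).smul (mul_ne_zero hμ0 hβ0)
  · fin_cases k
    · exact absurd rfl hk
    · have : V (stdVec 0 + stdVec 1) = μ • U (stdVec 0 + α • stdVec 1) := by
        rw [hVv]; simp [stdVec_apply]
      exact this ▸ (hα' hk).smul hμ0
    · have : V (stdVec 0 + stdVec 2) = μ • U (stdVec 0 + β • stdVec 2) := by
        rw [hVv]; simp [stdVec_apply]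
      exact this ▸ (hβ' hk).smul hμ0

/-! ### Coordinates of an image point relative to the frame -/

namespace AgreesOnFrame

/-- Distances to the coordinate points determine the moduli of the homogeneous coordinates.
Normalizing the first coordinate to `1` removes the remaining scalar freedom. -/
theorem exists_coord {U : C3 →L[ℂ] C3} {T : Equiv.Perm CP2} (h : AgreesOnFrame U T)
    (hT : ∀ p q, fsDist (T p) (T q) = fsDist p q) {v : C3} (hv : v ≠ 0) :
    ∃ w, IsRep (U w) (T (Projectivization.mk ℂ v hv)) ∧ ‖w‖ = ‖v‖ ∧
      (∀ l, ‖w l‖ = ‖v l‖) ∧ (v 0 = 1 → w 0 = 1) := by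
  obtain ⟨w, hw⟩ := h.isSU.exists_isRep (T (Projectivization.mk ℂ v hv))
  have hw0 : w ≠ 0 := fun h => hw.ne_zero (by rw [h, map_zero])
  have hnw := norm_ne_zero_iff.2 hw0
  have hnv := norm_ne_zero_iff.2 hv
  have hl : ∀ l, ‖w l‖ * ‖v‖ = ‖v l‖ * ‖w‖ := by
    intro l
    have h := IsRep.norm_inner_eq hT (IsRep.mk (stdVec_ne_zero l))
      (IsRep.mk hv) (h.map_stdVec l) hw
    rwa [AgreesOnFrame.isSU ‹_› |>.inner_map, inner_stdVec, inner_stdVec,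
      AgreesOnFrame.isSU ‹_› |>.norm_map, AgreesOnFrame.isSU ‹_› |>.norm_map, norm_stdVec,
      one_mul, one_mul] at h
  have key : ∃ c : ℂ, c ≠ 0 ∧ ‖c‖ * ‖w‖ = ‖v‖ ∧ (v 0 = 1 → c * w 0 = 1) := by
    by_cases h0 : v 0 = 1
    · have h1 := hl 0
      rw [h0, norm_one, one_mul] at h1
      have hw00 : w 0 ≠ 0 := by
        intro h
        rw [h, norm_zero, zero_mul] at h1
        exact hnw h1.symm
      refine ⟨(w 0)⁻¹, inv_ne_zero hw00, ?_, fun _ => inv_mul_cancel₀ hw00⟩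
      rw [← h1, norm_inv, ← mul_assoc, inv_mul_cancel₀ (norm_ne_zero_iff.2 hw00), one_mul]
    · refine ⟨((‖v‖ / ‖w‖ : ℝ) : ℂ), ?_, ?_, fun h => absurd h h0⟩
      · exact Complex.ofReal_ne_zero.2 (div_ne_zero hnv hnw)
      · rw [Complex.norm_real, Real.norm_of_nonneg (by positivity), div_mul_cancel₀ _ hnw]
  obtain ⟨c, hc, hcw, hc0⟩ := key
  refine ⟨c • w, by rw [map_smul]; exact hw.smul hc, by rw [norm_smul, hcw], fun l => ?_,
    fun h => by simpa using hc0 h⟩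
  have : ‖w l‖ * (‖c‖ * ‖w‖) = ‖v l‖ * ‖w‖ := by rw [hcw, hl]
  rw [PiLp.smul_apply, norm_smul]
  apply mul_right_cancel₀ hnw
  linarith

theorem norm_one_add {U : C3 →L[ℂ] C3} {T : Equiv.Perm CP2} (h : AgreesOnFrame U T)
    (hT : ∀ p q, fsDist (T p) (T q) = fsDist p q) {v w : C3} (hv : v ≠ 0)
    (hw : IsRep (U w) (T (Projectivization.mk ℂ v hv))) (hvw : ‖w‖ = ‖v‖) {k : Fin 3}
    (hk : k ≠ 0) : ‖w 0 + w k‖ = ‖v 0 + v k‖ := by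
  have h1 := IsRep.norm_inner_eq hT (IsRep.mk (stdVec_add_ne_zero hk)) (IsRep.mk hv)
    (h.map_stdVec_add k hk) hw
  rw [h.isSU.inner_map, inner_stdVec_add, inner_stdVec_add, h.isSU.norm_map, h.isSU.norm_map,
    hvw] at h1
  exact mul_right_cancel₀ (mul_ne_zero (norm_ne_zero_iff.2 (stdVec_add_ne_zero hk))
    (norm_ne_zero_iff.2 hv)) h1

/-- The invariant is affine in the coordinate `w k` itself, so it records the sign of the imaginary
part, which distances cannot see. -/
theorem bargmann_eq {U : C3 →L[ℂ] C3} {T : Equiv.Perm CP2} (h : AgreesOnFrame U T)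
    {v w : C3} (hv : v ≠ 0) (hw : IsRep (U w) (T (Projectivization.mk ℂ v hv)))
    (hvw : ‖w‖ = ‖v‖) (hw0 : w 0 = 1) {k : Fin 3} (hk : k ≠ 0) :
    bargmann (T (Projectivization.mk ℂ (stdVec 0) (stdVec_ne_zero 0)))
      (T (Projectivization.mk ℂ (stdVec 0 + stdVec k) (stdVec_add_ne_zero hk)))
      (T (Projectivization.mk ℂ v hv)) = (1 + w k) / ((2 * ‖v‖ ^ 2 : ℝ) : ℂ) := by
  rw [_root_.bargmann_eq (h.map_stdVec 0) (h.map_stdVec_add k hk) hw]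
  simp only [h.isSU.inner_map, h.isSU.norm_map, norm_stdVec, norm_sq_stdVec_add hk,
    inner_stdVec_add, inner_stdVec, hvw, hw0]
  rw [← inner_conj_symm w, inner_stdVec, hw0]
  simp [stdVec_apply, hk.symm]

end AgreesOnFrame

theorem AgreesOnFrame.one : AgreesOnFrame (ContinuousLinearMap.id ℂ C3) 1 :=
  ⟨⟨fun _ _ => rfl, fun _ _ => rfl⟩, fun k => IsRep.mk (stdVec_ne_zero k),
    fun _ hk => IsRep.mk (stdVec_add_ne_zero hk)⟩

/-- Circles centred at `0` and at `-1` meet in a pair of conjugate points: the unitary or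
antiunitary alternative of Wigner's theorem. -/
theorem Complex.re_eq_and_im_sq_eq {a b : ℂ} (h : ‖a‖ = ‖b‖) (h1 : ‖1 + a‖ = ‖1 + b‖) :
    a.re = b.re ∧ a.im ^ 2 = b.im ^ 2 := by
  have e := congrArg (· ^ 2) h
  have e1 := congrArg (· ^ 2) h1
  simp only [← Complex.normSq_eq_norm_sq, Complex.normSq_apply, Complex.add_re, Complex.add_im,
    Complex.one_re, Complex.one_im] at e e1
  constructor
  · linarith
  · have : a.re = b.re := by linarith
    rw [this] at e
    linarith

namespace IsOneParameterIsometryGroup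

variable {R : ℝ → Equiv.Perm CP2}

/-- Distances leave each coordinate determined up to conjugation. Its imaginary part is continuous
in time, by continuity of the Bargmann invariant, and has constant square, so it cannot change sign;
at time `0` it has the right one. -/
theorem isRep_of_coord_zero_eq_one (hR : IsOneParameterIsometryGroup R)
    {U : ℝ → C3 →L[ℂ] C3} (hU : ∀ t, AgreesOnFrame (U t) (R t)) {v : C3} (hv : v ≠ 0)
    (hv0 : v 0 = 1) (t : ℝ) : IsRep (U t v) (R t (Projectivization.mk ℂ v hv)) := by
  choose w hw hnw hwl hw0 using fun t => (hU t).exists_coord (hR.isometry t) hv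
  suffices hk : ∀ k, k ≠ 0 → w t k = v k by
    have : w t = v := by
      ext l
      by_cases hl : l = 0
      · rw [hl, hw0 t hv0, hv0]
      · exact hk l hl
    exact this ▸ hw t
  intro k hk
  have hre : ∀ s, (w s k).re = (v k).re ∧ (w s k).im ^ 2 = (v k).im ^ 2 := by
    intro s
    apply Complex.re_eq_and_im_sq_eq (hwl s k)
    have := (hU s).norm_one_add (hR.isometry s) hv (hw s) (hnw s) hk
    rwa [hw0 s hv0, hv0] at this
  have hB := fun s => (hU s).bargmann_eq hv (hw s) (hnw s) (hw0 s hv0) hk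
  have hvn : ((2 * ‖v‖ ^ 2 : ℝ) : ℂ) ≠ 0 := by
    have := norm_ne_zero_iff.2 hv
    exact Complex.ofReal_ne_zero.2 (by positivity)
  -- `U 0` was chosen arbitrarily and need not be the identity, so the invariant of `R 0 = 1` is
  -- computed both with `U 0` and with the identity.
  have hB0 : w 0 k = v k := by
    have h0 := hB 0
    rw [hR.map_zero, AgreesOnFrame.one.bargmann_eq hv (IsRep.mk hv) rfl hv0 hk,
      div_left_inj' hvn] at h0
    exact (add_left_cancel h0).symm
  have hcont : Continuous fun s => (w s k).im := by
    have h1 := hR.continuous_bargmann (Projectivization.mk ℂ (stdVec 0) (stdVec_ne_zero 0))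
      (Projectivization.mk ℂ (stdVec 0 + stdVec k) (stdVec_add_ne_zero hk))
      (Projectivization.mk ℂ v hv)
    simp only [hB] at h1
    have h2 : Continuous fun s => w s k := by
      have h3 : Continuous fun s => (1 + w s k) / ((2 * ‖v‖ ^ 2 : ℝ) : ℂ) * ((2 * ‖v‖ ^ 2 : ℝ) : ℂ)
          - 1 := (h1.mul continuous_const).sub continuous_const
      simpa only [div_mul_cancel₀ _ hvn, add_sub_cancel_left] using h3
    exact Complex.continuous_im.comp h2
  apply Complex.ext (hre t).1
  by_cases him : (v k).im = 0
  · have := (hre t).2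
    rw [him] at this ⊢
    simpa using this
  · exact isPreconnected_univ.eq_of_sq_eq hcont.continuousOn continuousOn_const
      (fun s _ => (hre s).2) (fun _ => him) (Set.mem_univ 0) (congrArg Complex.im hB0)
      (Set.mem_univ t)

/-- Every member of a continuous one-parameter group of isometries of `ℂP²` is induced by a special
unitary map. -/
theorem exists_isSU (hR : IsOneParameterIsometryGroup R) (t : ℝ) :
    ∃ U : C3 →L[ℂ] C3, IsSU U ∧ ∀ v p, IsRep v p → IsRep (U v) (R t p) := by
  choose U hU using fun t => exists_agreesOnFrame (hR.isometry t)
  have hone : ∀ v (hv : v ≠ 0), v 0 = 1 → IsRep (U t v) (R t (Projectivization.mk ℂ v hv)) :=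
    fun v hv hv0 => hR.isRep_of_coord_zero_eq_one hU hv hv0 t
  refine ⟨U t, (hU t).isSU, fun v p hvp => ?_⟩
  obtain ⟨hv, rfl⟩ := hvp
  by_cases hv0 : v 0 = 0
  · obtain ⟨w, hw, hnw, hwl, -⟩ := (hU t).exists_coord (hR.isometry t) hv
    -- Points with vanishing first coordinate are reached through an auxiliary `u ⊥ v` with first
    -- coordinate `1`, where the result is known. Orthogonality of `u` and `w`, with the moduli of
    -- the coordinates, forces `w` to be proportional to `v`.
    set u : C3 := WithLp.toLp 2 ![1, -star (v 2), star (v 1)] with hu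
    have u0 : u 0 = 1 := rfl
    have u1 : u 1 = -star (v 2) := rfl
    have u2 : u 2 = star (v 1) := rfl
    have hune : u ≠ 0 := fun h => by rw [h] at u0; simp at u0
    have horth : inner ℂ u v = 0 := by
      rw [C3.inner_eq, u0, u1, u2, hv0]; simp; ring
    have h1 := IsRep.norm_inner_eq (hR.isometry t) (IsRep.mk hune) (IsRep.mk hv)
      (hone u hune u0) hw
    rw [(hU t).isSU.inner_map, horth, norm_zero, zero_mul] at h1
    have h2 : inner ℂ u w = 0 := by
      have := norm_ne_zero_iff.2 hune
      have := norm_ne_zero_iff.2 hv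
      simpa [*] using h1
    have w0 : w 0 = 0 := by
      have := hwl 0
      rwa [hv0, norm_zero, norm_eq_zero] at this
    rw [C3.inner_eq, u0, u1, u2, w0] at h2
    simp only [star_one, mul_zero, star_neg, star_star, zero_add] at h2
    by_cases h10 : v 1 = 0
    · have h20 : v 2 ≠ 0 := by
        intro h
        exact hv (C3.ext_coord hv0 h10 h)
      have hw2 : w 2 ≠ 0 := by
        intro h
        have := hwl 2
        rw [h, norm_zero, eq_comm, norm_eq_zero] at this
        exact h20 this
      have : v = (v 2 / w 2) • w := by
        have hw1 : w 1 = 0 := by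
          have := hwl 1
          rwa [h10, norm_zero, norm_eq_zero] at this
        apply C3.ext_coord <;> simp [hv0, w0, h10, hw1, hw2]
      have h' := hw.smul (div_ne_zero h20 hw2)
      rwa [← map_smul, ← this] at h'
    · have hw1 : w 1 ≠ 0 := by
        intro h
        have := hwl 1
        rw [h, norm_zero, eq_comm, norm_eq_zero] at this
        exact h10 this
      have : v = (v 1 / w 1) • w := by
        apply C3.ext_coord
        · simp [hv0, w0]
        · simp [hw1]
        · simp only [PiLp.smul_apply, smul_eq_mul]
          field_simp
          linear_combination -h2
      have h' := hw.smul (div_ne_zero h10 hw1)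
      rwa [← map_smul, ← this] at h'
  · have hne : (v 0)⁻¹ • v ≠ 0 := smul_ne_zero (inv_ne_zero hv0) hv
    have h1 := (hone _ hne (by simp [hv0])).smul hv0
    rw [map_smul, smul_smul, mul_inv_cancel₀ hv0, one_smul] at h1
    convert h1 using 2
    exact ((IsRep.mk hv).smul (inv_ne_zero hv0)).unique (IsRep.mk hne)

end IsOneParameterIsometryGroup

/-! ### Special lifts

A special lift is a smooth lift to `S⁵` that is special Legendrian and conformal. -/

/-- The pointwise conditions on a special lift. -/
structure IsSpecialAt (F : ℂ → C3) (z : ℂ) : Prop where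
  norm_eq : ‖F z‖ = 1
  horizontal : ∀ X, inner ℂ (F z) (fderiv ℝ F z X) = 0
  map_I : ∀ X, fderiv ℝ F z (Complex.I * X) = jc (F z) (fderiv ℝ F z X)
  ne_zero : fderiv ℝ F z 1 ≠ 0

/-- `F` is a special lift on the open set `V`. -/
structure IsSpecialOn (F : ℂ → C3) (V : Set ℂ) : Prop where
  isOpen : IsOpen V
  smooth : ContDiffOn ℝ ∞ F V
  special : ∀ z ∈ V, IsSpecialAt F z

/-! ### Calculus for local lifts -/

theorem fderiv_eq_re_im (L : ℂ →L[ℝ] C3) (X : ℂ) : L X = X.re • L 1 + X.im • L Complex.I := by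
  conv_lhs => rw [← Complex.re_add_im X]
  have h1 : ((X.re : ℂ)) = X.re • (1 : ℂ) := by simp
  have h2 : ((X.im : ℂ)) * Complex.I = X.im • Complex.I := by simp
  rw [h1, h2, map_add, map_smul, map_smul]

theorem HasFDerivAt.jc {E : Type*} [NormedAddCommGroup E] [NormedSpace ℝ E] {W₁ W₂ : E → C3}
    {W₁' W₂' : E →L[ℝ] C3} {z : E} (h₁ : HasFDerivAt W₁ W₁' z) (h₂ : HasFDerivAt W₂ W₂' z) :
    HasFDerivAt (fun z => _root_.jc (W₁ z) (W₂ z))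
      (jcL.precompR E (W₁ z) W₂' + jcL.precompL E W₁' (W₂ z)) z :=
  jcL.hasFDerivAt_of_bilinear h₁ h₂

theorem fderiv_jc {E : Type*} [NormedAddCommGroup E] [NormedSpace ℝ E] {W₁ W₂ : E → C3} {z : E}
    (h₁ : DifferentiableAt ℝ W₁ z) (h₂ : DifferentiableAt ℝ W₂ z) (X : E) :
    fderiv ℝ (fun z => jc (W₁ z) (W₂ z)) z X =
      jc (W₁ z) (fderiv ℝ W₂ z X) + jc (fderiv ℝ W₁ z X) (W₂ z) := by
  rw [(h₁.hasFDerivAt.jc h₂.hasFDerivAt).fderiv]; rfl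

theorem HasDerivAt.jc {W₁ W₂ : ℝ → C3} {W₁' W₂' : C3} {t : ℝ} (h₁ : HasDerivAt W₁ W₁' t)
    (h₂ : HasDerivAt W₂ W₂' t) : HasDerivAt (fun t => _root_.jc (W₁ t) (W₂ t))
      (_root_.jc (W₁ t) W₂' + _root_.jc W₁' (W₂ t)) t := by
  have := (h₁.hasFDerivAt.jc h₂.hasFDerivAt).hasDerivAt
  simpa [ContinuousLinearMap.precompR, ContinuousLinearMap.precompL] using this

theorem ContDiffOn.jc {W₁ W₂ : ℂ → C3} {V : Set ℂ} {n : WithTop ℕ∞} (h₁ : ContDiffOn ℝ n W₁ V)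
    (h₂ : ContDiffOn ℝ n W₂ V) : ContDiffOn ℝ n (fun z => _root_.jc (W₁ z) (W₂ z)) V :=
  jcL.isBoundedBilinearMap.contDiff.comp_contDiffOn (h₁.prodMk h₂)

theorem ContDiffOn.fderiv_apply_const {F : ℂ → C3} {V : Set ℂ} (hV : IsOpen V)
    (hF : ContDiffOn ℝ ∞ F V) (X : ℂ) : ContDiffOn ℝ ∞ (fun z => fderiv ℝ F z X) V :=
  (hF.fderiv_of_isOpen hV (by simp)).clm_apply contDiffOn_const

theorem ContDiffOn.differentiableAt_of_mem {E : Type*} [NormedAddCommGroup E] [NormedSpace ℝ E]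
    {F : ℂ → E} {V : Set ℂ} (hV : IsOpen V)
    (hF : ContDiffOn ℝ ∞ F V) {z : ℂ} (hz : z ∈ V) : DifferentiableAt ℝ F z :=
  (hF.contDiffAt (hV.mem_nhds hz)).differentiableAt (by simp)

theorem fderiv_fderiv_apply_comm {F : ℂ → C3} {V : Set ℂ} (hV : IsOpen V)
    (hF : ContDiffOn ℝ ∞ F V) {z : ℂ} (hz : z ∈ V) (X Y : ℂ) :
    fderiv ℝ (fun z => fderiv ℝ F z Y) z X = fderiv ℝ (fun z => fderiv ℝ F z X) z Y := by
  have hd : DifferentiableAt ℝ (fderiv ℝ F) z :=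
    ((hF.fderiv_of_isOpen hV (m := ∞) (by simp)).contDiffAt (hV.mem_nhds hz)).differentiableAt
      (by simp)
  have hs : IsSymmSndFDerivAt ℝ F z :=
    (hF.contDiffAt (hV.mem_nhds hz)).isSymmSndFDerivAt
      (by simpa using WithTop.coe_le_coe.2 (le_top : (2 : ℕ∞) ≤ ⊤))
  have e : ∀ X Y, fderiv ℝ (fun z => fderiv ℝ F z Y) z X = fderiv ℝ (fderiv ℝ F) z X Y := by
    intro X Y
    rw [fderiv_clm_apply hd (differentiableAt_const Y)]
    simp
  rw [e, e]
  exact hs X Y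

theorem lineCoeff_eq_zero {v w : C3} (h : inner ℂ v w = 0) : lineCoeff v w = 0 := by
  simp [lineCoeff, h]

theorem horPart_eq_self {v w : C3} (h : inner ℂ v w = 0) : horPart v w = w := by
  simp [horPart, lineCoeff_eq_zero h]

theorem horPart_smul_self {v : C3} (hv : v ≠ 0) (c : ℂ) : horPart v (c • v) = 0 := by
  have : inner ℂ v v ≠ 0 := by simpa using hv
  rw [horPart, lineCoeff, inner_smul_right, mul_div_assoc, div_self this, mul_one, sub_self]

namespace IsSpecialAt

variable {F : ℂ → C3} {z : ℂ}

theorem tangentVec_eq (h : IsSpecialAt F z) (X : ℂ) : tangentVec F X z = fderiv ℝ F z X :=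
  horPart_eq_self (h.horizontal X)

theorem fderiv_I (h : IsSpecialAt F z) :
    fderiv ℝ F z Complex.I = jc (F z) (fderiv ℝ F z 1) := by
  simpa using h.map_I 1

theorem fderiv_one (h : IsSpecialAt F z) :
    fderiv ℝ F z 1 = -jc (F z) (fderiv ℝ F z Complex.I) := by
  have := h.map_I Complex.I
  rw [Complex.I_mul_I, map_neg] at this
  rw [← this, neg_neg]

theorem fderiv_ne_zero (h : IsSpecialAt F z) {X : ℂ} (hX : X ≠ 0) : fderiv ℝ F z X ≠ 0 := by
  intro h0
  have hI : fderiv ℝ F z (Complex.I * X) = 0 := by rw [h.map_I, h0]; simpa using jc_smul_right 0 _ 0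
  apply h.ne_zero
  have h1 : (1 : ℂ) = (X⁻¹).re • X + (X⁻¹).im • (Complex.I * X) := by
    have : X⁻¹ * X = 1 := inv_mul_cancel₀ hX
    conv_lhs => rw [← this, ← Complex.re_add_im X⁻¹]
    simp only [Complex.real_smul]; ring
  rw [h1, map_add, map_smul, map_smul, h0, hI]; simp

/-- `F_y = F × F_x` is Hermitian orthogonal to `F_x` and of the same length. Reality of the result
is the Lagrangian condition, and its shape is conformality. -/
theorem inner_fderiv (h : IsSpecialAt F z) (X Y : ℂ) :
    inner ℂ (fderiv ℝ F z X) (fderiv ℝ F z Y) =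
      ((‖fderiv ℝ F z 1‖ ^ 2 * (X.re * Y.re + X.im * Y.im) : ℝ) : ℂ) := by
  have h0 := h.horizontal 1
  have e1 : inner ℂ (fderiv ℝ F z 1) (fderiv ℝ F z 1) = (‖fderiv ℝ F z 1‖ : ℂ) ^ 2 :=
    inner_self_eq_norm_sq_to_K _
  have e2 : inner ℂ (fderiv ℝ F z 1) (fderiv ℝ F z Complex.I) = 0 := by
    rw [h.fderiv_I]; exact inner_jc_right _ _
  have e3 : inner ℂ (fderiv ℝ F z Complex.I) (fderiv ℝ F z 1) = 0 := by
    rw [← inner_conj_symm, e2, map_zero]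
  have e4 : inner ℂ (fderiv ℝ F z Complex.I) (fderiv ℝ F z Complex.I)
      = (‖fderiv ℝ F z 1‖ : ℂ) ^ 2 := by
    rw [inner_self_eq_norm_sq_to_K, h.fderiv_I, norm_jc_of_inner_eq_zero h0, h.norm_eq, one_mul]
    rfl
  rw [fderiv_eq_re_im _ X, fderiv_eq_re_im _ Y]
  simp only [inner_add_left, inner_add_right, RCLike.real_smul_eq_coe_smul (K := ℂ),
    inner_smul_left, inner_smul_right, e1, e2, e3, e4]
  simp
  ring

theorem inducedMetric_eq (h : IsSpecialAt F z) (X Y : ℂ) :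
    inducedMetric F z X Y = ‖fderiv ℝ F z 1‖ ^ 2 * (X.re * Y.re + X.im * Y.im) := by
  rw [inducedMetric, fsHermitian, h.tangentVec_eq, h.tangentVec_eq, h.inner_fderiv, h.norm_eq]
  simp [-Complex.ofReal_mul, -Complex.ofReal_pow]

theorem isConformalImmersionAt (h : IsSpecialAt F z) : IsConformalImmersionAt F z := by
  have := norm_pos_iff.2 h.ne_zero
  refine ⟨?_, ?_, ?_⟩ <;> simp only [h.inducedMetric_eq] <;> simp
  · positivity

theorem isLagrangianAt (h : IsSpecialAt F z) : IsLagrangianAt F z := by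
  intro X Y
  rw [inducedKahlerForm, fsHermitian, h.tangentVec_eq, h.tangentVec_eq, h.inner_fderiv, h.norm_eq]
  simp [-Complex.ofReal_mul, -Complex.ofReal_pow]

end IsSpecialAt

/-- Differentiating `F_y = F × F_x` in `y` and `F_x = -F × F_y` in `x`, the mixed derivatives cancel
in the sum, leaving `F_xx + F_yy = -2‖F_x‖² F`. This has no horizontal part, so the whole metric
trace vanishes. -/
theorem IsSpecialOn.isMinimalAt {F : ℂ → C3} {V : Set ℂ} (h : IsSpecialOn F V) {z : ℂ}
    (hz : z ∈ V) : IsMinimalAt F z := by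
  have hs := h.special z hz
  have hnhds := h.isOpen.mem_nhds hz
  have hF : DifferentiableAt ℝ F z := h.smooth.differentiableAt_of_mem h.isOpen hz
  have hdF : ∀ X, DifferentiableAt ℝ (fun z => fderiv ℝ F z X) z := fun X =>
    (h.smooth.fderiv_apply_const h.isOpen X).differentiableAt_of_mem h.isOpen hz
  have hsec : ∀ X Y, secondDeriv F X Y z =
      horPart (F z) (fderiv ℝ (fun z => fderiv ℝ F z Y) z X) := by
    intro X Y
    have : tangentVec F Y =ᶠ[𝓝 z] fun z => fderiv ℝ F z Y := by
      filter_upwards [hnhds] with w hw using (h.special w hw).tangentVec_eq Y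
    rw [secondDeriv, covDeriv, this.fderiv_eq, lineCoeff_eq_zero (hs.horizontal X), zero_smul,
      sub_zero]
  have hII : fderiv ℝ (fun z => fderiv ℝ F z Complex.I) z Complex.I =
      jc (F z) (fderiv ℝ (fun z => fderiv ℝ F z 1) z Complex.I)
        + jc (fderiv ℝ F z Complex.I) (fderiv ℝ F z 1) := by
    have : (fun z => fderiv ℝ F z Complex.I) =ᶠ[𝓝 z] fun z => jc (F z) (fderiv ℝ F z 1) := by
      filter_upwards [hnhds] with w hw using (h.special w hw).fderiv_I
    rw [this.fderiv_eq, fderiv_jc hF (hdF 1)]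
  have h11 : fderiv ℝ (fun z => fderiv ℝ F z 1) z 1 =
      -(jc (F z) (fderiv ℝ (fun z => fderiv ℝ F z Complex.I) z 1)
        + jc (fderiv ℝ F z 1) (fderiv ℝ F z Complex.I)) := by
    have : (fun z => fderiv ℝ F z 1) =ᶠ[𝓝 z] fun z => -jc (F z) (fderiv ℝ F z Complex.I) := by
      filter_upwards [hnhds] with w hw using (h.special w hw).fderiv_one
    rw [this.fderiv_eq, fderiv_fun_neg, neg_apply, fderiv_jc hF (hdF _)]
  have hsum : fderiv ℝ (fun z => fderiv ℝ F z 1) z 1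
      + fderiv ℝ (fun z => fderiv ℝ F z Complex.I) z Complex.I =
      (-2 * (‖fderiv ℝ F z 1‖ : ℂ) ^ 2) • F z := by
    have e : jc (fderiv ℝ F z 1) (jc (F z) (fderiv ℝ F z 1)) =
        (‖fderiv ℝ F z 1‖ : ℂ) ^ 2 • F z := by
      rw [jc_jc, ← inner_conj_symm _ (F z), hs.horizontal, map_zero, zero_smul, sub_zero,
        inner_self_eq_norm_sq_to_K]; rfl
    rw [h11, hII, fderiv_fderiv_apply_comm h.isOpen h.smooth hz 1 Complex.I,
      jc_swap (fderiv ℝ F z Complex.I), hs.fderiv_I, e]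
    module
  have htr : metricTrace F z = 0 := by
    have hne : F z ≠ 0 := by rw [← norm_ne_zero_iff, hs.norm_eq]; simp
    have e : horPart (F z) (fderiv ℝ (fun z => fderiv ℝ F z 1) z 1)
        + horPart (F z) (fderiv ℝ (fun z => fderiv ℝ F z Complex.I) z Complex.I) = 0 := by
      rw [← horPart_smul_self hne (-2 * (‖fderiv ℝ F z 1‖ : ℂ) ^ 2), ← hsum]
      simp only [horPart, lineCoeff, inner_add_right]
      module
    rw [metricTrace]
    simp only [hs.inducedMetric_eq, hsec]
    simp only [Complex.I_re, Complex.I_im, Complex.one_re, Complex.one_im]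
    simp only [mul_zero, mul_one, zero_add, add_zero, zero_smul, sub_zero, ← smul_add]
    rw [e, smul_zero]
  intro ν _ _
  rw [htr, inner_zero_left]; rfl

/-- The pointwise relation between a map to `ℂP²` and a lift. -/
def IsLiftOn (F : ℂ → C3) (f : ℂ → CP2) (V : Set ℂ) : Prop := ∀ z ∈ V, IsRep (F z) (f z)

theorem isMinimalLagrangianImmersion_of_special {f : ℂ → CP2} {U : Set ℂ}
    (h : ∀ p ∈ U, ∃ (V : Set ℂ) (F : ℂ → C3), p ∈ V ∧ V ⊆ U ∧ IsSpecialOn F V ∧ IsLiftOn F f V) :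
    IsMinimalLagrangianImmersion f U := by
  intro p hp
  obtain ⟨V, F, hpV, hVU, hF, hl⟩ := h p hp
  exact ⟨V, F, hpV, hVU, ⟨hF.isOpen, hF.smooth, hl⟩, fun z hz =>
    ⟨(hF.special z hz).isConformalImmersionAt, (hF.special z hz).isLagrangianAt,
      hF.isMinimalAt hz⟩⟩

namespace IsSpecialOn

variable {F G : ℂ → C3} {V W : Set ℂ}

theorem mono (h : IsSpecialOn F V) (hW : IsOpen W) (hWV : W ⊆ V) : IsSpecialOn F W :=
  ⟨hW, h.smooth.mono hWV, fun z hz => h.special z (hWV hz)⟩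

/-- A holomorphic derivative is multiplication by a complex number and therefore commutes with
multiplication by `I`. -/
theorem comp (h : IsSpecialOn F V) {φ φ' : ℂ → ℂ} (hW : IsOpen W) (hφ : ContDiffOn ℝ ∞ φ W)
    (hmaps : Set.MapsTo φ W V) (hd : ∀ w ∈ W, HasDerivAt φ (φ' w) w) (hne : ∀ w ∈ W, φ' w ≠ 0) :
    IsSpecialOn (F ∘ φ) W := by
  refine ⟨hW, h.smooth.comp hφ hmaps, fun w hw => ?_⟩
  have hs := h.special _ (hmaps hw)
  have hF := h.smooth.differentiableAt_of_mem h.isOpen (hmaps hw)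
  have e : ∀ X, fderiv ℝ (F ∘ φ) w X = fderiv ℝ F (φ w) (φ' w * X) := by
    intro X
    have h1 : HasFDerivAt φ (ContinuousLinearMap.restrictScalars ℝ
      (ContinuousLinearMap.toSpanSingleton ℂ (φ' w))) w := (hd w hw).hasFDerivAt.restrictScalars ℝ
    rw [(hF.hasFDerivAt.comp w h1).fderiv]
    simp [mul_comm]
  refine ⟨hs.norm_eq, fun X => ?_, fun X => ?_, ?_⟩
  · rw [e]; exact hs.horizontal _
  · rw [e, e, mul_left_comm]; exact hs.map_I _
  · rw [e, mul_one]; exact hs.fderiv_ne_zero (hne w hw)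

theorem map (h : IsSpecialOn F V) {U : C3 →L[ℂ] C3} (hU : IsSU U) :
    IsSpecialOn (fun z => U (F z)) V := by
  have e : ∀ z ∈ V, ∀ X, fderiv ℝ (fun z => U (F z)) z X = U (fderiv ℝ F z X) := by
    intro z hz X
    have hF := (h.smooth.differentiableAt_of_mem h.isOpen hz).hasFDerivAt
    have := ((U.restrictScalars ℝ).hasFDerivAt (x := F z)).comp z hF
    have e2 : (fun z => U (F z)) = (U.restrictScalars ℝ) ∘ F := rfl
    rw [e2, this.fderiv]; rfl
  refine ⟨h.isOpen, (U.restrictScalars ℝ).contDiff.comp_contDiffOn h.smooth, fun z hz => ?_⟩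
  have hs := h.special z hz
  refine ⟨by rw [hU.norm_map, hs.norm_eq], fun X => ?_, fun X => ?_, ?_⟩
  · rw [e z hz, hU.inner_map, hs.horizontal]
  · rw [e z hz, e z hz, hs.map_I, hU.map_jc]
  · rw [e z hz]; exact hU.map_ne_zero hs.ne_zero

/-- Two special lifts of the same map differ by a cube root of unity. -/
theorem eq_smul (hF : IsSpecialOn F V) (hG : IsSpecialOn G V) (hV : IsPreconnected V)
    (hFG : ∀ z ∈ V, ∃ c : ℂ, F z = c • G z) : ∃ c : ℂ, c ^ 3 = 1 ∧ ∀ z ∈ V, F z = c • G z := by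
  rcases V.eq_empty_or_nonempty with rfl | ⟨z₀, hz₀⟩
  · exact ⟨1, by simp, by simp⟩
  set l : ℂ → ℂ := fun z => inner ℂ (G z) (F z) with hl
  have hlF : ∀ z ∈ V, F z = l z • G z := by
    intro z hz
    obtain ⟨c, hc⟩ := hFG z hz
    have : l z = c := by
      simp only [hl]
      rw [hc, inner_smul_right, inner_self_eq_norm_sq_to_K, (hG.special z hz).norm_eq]; simp
    rw [this, hc]
  have hl1 : ∀ z ∈ V, ‖l z‖ = 1 := by
    intro z hz
    have := congrArg norm (hlF z hz)
    rwa [norm_smul, (hF.special z hz).norm_eq, (hG.special z hz).norm_eq, mul_one, eq_comm] at this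
  -- Both lifts are horizontal, so the derivative of either is orthogonal to the common line, and
  -- the phase has zero derivative.
  have hldiff : ∀ z ∈ V, ∀ X, fderiv ℝ l z X = 0 := by
    intro z hz X
    have dF := hF.smooth.differentiableAt_of_mem hF.isOpen hz
    have dG := hG.smooth.differentiableAt_of_mem hG.isOpen hz
    simp only [hl]
    rw [fderiv_inner_apply ℂ dG dF]
    have h1 : inner ℂ (fderiv ℝ G z X) (F z) = 0 := by
      rw [hlF z hz, inner_smul_right, ← inner_conj_symm, (hG.special z hz).horizontal]; simp
    have h2 : inner ℂ (G z) (fderiv ℝ F z X) = 0 := by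
      have := (hF.special z hz).horizontal X
      have hne : l z ≠ 0 := by rw [← norm_ne_zero_iff, hl1 z hz]; simp
      rw [hlF z hz, inner_smul_left] at this
      simpa [hne] using this
    rw [h1, h2, add_zero]
  have hdl : DifferentiableOn ℝ l V := fun z hz =>
    ((hG.smooth.differentiableAt_of_mem hG.isOpen hz).inner ℂ
      (hF.smooth.differentiableAt_of_mem hF.isOpen hz)).differentiableWithinAt
  have hconst : ∀ z ∈ V, l z = l z₀ := by
    intro z hz
    refine hF.isOpen.is_const_of_fderiv_eq_zero hV hdl ?_ hz hz₀
    intro w hw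
    ext1; simp [hldiff w hw]
  refine ⟨l z₀, ?_, fun z hz => by rw [hlF z hz, hconst z hz]⟩
  have heq : F =ᶠ[𝓝 z₀] fun z => l z₀ • G z := by
    filter_upwards [hF.isOpen.mem_nhds hz₀] with z hz
    rw [hlF z hz, hconst z hz]
  have hd : ∀ X, fderiv ℝ F z₀ X = l z₀ • fderiv ℝ G z₀ X := by
    intro X
    rw [heq.fderiv_eq, fderiv_fun_const_smul
      (hG.smooth.differentiableAt_of_mem hG.isOpen hz₀)]
    rfl
  -- Comparing the two equations `F_y = F × F_x` and `G_y = G × G_x` gives `l = l̄²`, hence `l³ =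
  -- 1`.
  have h1 := (hF.special z₀ hz₀).fderiv_I
  rw [hd, hd, hlF z₀ hz₀, jc_smul_left, jc_smul_right, ← (hG.special z₀ hz₀).fderiv_I,
    smul_smul] at h1
  have h2 := smul_left_injective ℂ ((hG.special z₀ hz₀).fderiv_ne_zero Complex.I_ne_zero) h1
  have h3 : star (l z₀) * l z₀ = 1 := by
    simp [RCLike.star_def, Complex.conj_mul', hl1 z₀ hz₀]
  rw [pow_succ]
  linear_combination (l z₀) ^ 2 * h2 + (star (l z₀) * l z₀ + 1) * h3

end IsSpecialOn

/-! ### Existence of special lifts -/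

theorem IsSpecialAt.of_fderiv_one {F : ℂ → C3} {z : ℂ} (h1 : ‖F z‖ = 1)
    (h2 : inner ℂ (F z) (fderiv ℝ F z 1) = 0)
    (h3 : fderiv ℝ F z Complex.I = jc (F z) (fderiv ℝ F z 1)) (h4 : fderiv ℝ F z 1 ≠ 0) :
    IsSpecialAt F z := by
  have hFF : inner ℂ (F z) (F z) = 1 := by rw [inner_self_eq_norm_sq_to_K, h1]; simp
  refine ⟨h1, fun X => ?_, fun X => ?_, h4⟩
  · rw [fderiv_eq_re_im _ X, h3, inner_add_right, RCLike.real_smul_eq_coe_smul (K := ℂ),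
      RCLike.real_smul_eq_coe_smul (K := ℂ), inner_smul_right, inner_smul_right, h2,
      inner_jc_left]
    simp
  · have h5 : jc (F z) (jc (F z) (fderiv ℝ F z 1)) = -fderiv ℝ F z 1 := by
      rw [jc_jc, hFF, h2]; simp
    rw [fderiv_eq_re_im _ X, fderiv_eq_re_im _ (Complex.I * X), h3, jc_add_right,
      jc_real_smul_right, jc_real_smul_right, h5]
    simp
    abel

/-! ### Algebra of the orthogonal splitting along a line -/

theorem horPart_add (v w w' : C3) : horPart v (w + w') = horPart v w + horPart v w' := by
  simp only [horPart, lineCoeff, inner_add_right, add_div]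
  module

theorem horPart_smul (v w : C3) (c : ℂ) : horPart v (c • w) = c • horPart v w := by
  simp only [horPart, lineCoeff, inner_smul_right, mul_div_assoc]
  module

theorem lineCoeff_smul_left (v w : C3) {c : ℂ} (hc : c ≠ 0) :
    lineCoeff (c • v) w = c⁻¹ * lineCoeff v w := by
  have : (starRingEnd ℂ) c ≠ 0 := by simpa using hc
  simp only [lineCoeff, inner_smul_left, inner_smul_right]
  field_simp

theorem horPart_smul_left (v w : C3) {c : ℂ} (hc : c ≠ 0) : horPart (c • v) w = horPart v w := by
  rw [horPart, lineCoeff_smul_left v w hc, smul_smul, mul_right_comm, inv_mul_cancel₀ hc,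
    one_mul, horPart]

theorem inner_horPart {v : C3} (hv : v ≠ 0) (w : C3) : inner ℂ v (horPart v w) = 0 := by
  have : inner ℂ v v ≠ 0 := by simpa using hv
  rw [horPart, lineCoeff, inner_sub_right, inner_smul_right, div_mul_cancel₀ _ this, sub_self]

/-! ### Change of lift by a nonvanishing function -/

section Rescaling

variable {F : ℂ → C3} {l : ℂ → ℂ} {z : ℂ}

theorem fderiv_smul_apply (hl : DifferentiableAt ℝ l z) (hF : DifferentiableAt ℝ F z) (X : ℂ) :
    fderiv ℝ (fun z => l z • F z) z X = l z • fderiv ℝ F z X + fderiv ℝ l z X • F z := by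
  rw [fderiv_fun_smul hl hF]; rfl

theorem tangentVec_smul (hl : DifferentiableAt ℝ l z) (hF : DifferentiableAt ℝ F z)
    (hl0 : l z ≠ 0) (hF0 : F z ≠ 0) (X : ℂ) :
    tangentVec (fun z => l z • F z) X z = l z • tangentVec F X z := by
  rw [tangentVec, fderiv_smul_apply hl hF, horPart_smul_left _ _ hl0, horPart_add, horPart_smul,
    horPart_smul_self hF0, add_zero, tangentVec]

theorem fsHermitian_smul (hl : DifferentiableAt ℝ l z) (hF : DifferentiableAt ℝ F z)
    (hl0 : l z ≠ 0) (hF0 : F z ≠ 0) (X Y : ℂ) :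
    fsHermitian (fun z => l z • F z) z X Y = fsHermitian F z X Y := by
  have h : (starRingEnd ℂ) (l z) ≠ 0 := by simpa using hl0
  rw [fsHermitian, tangentVec_smul hl hF hl0 hF0, tangentVec_smul hl hF hl0 hF0, inner_smul_left,
    inner_smul_right, fsHermitian, norm_smul, mul_pow, Complex.ofReal_mul, Complex.ofReal_pow ‖l z‖,
    ← Complex.conj_mul', ← mul_assoc, mul_div_mul_left _ _ (mul_ne_zero h hl0)]

end Rescaling

theorem ContDiffOn.complex_div {f g : ℂ → ℂ} {V : Set ℂ} (hf : ContDiffOn ℝ ∞ f V)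
    (hg : ContDiffOn ℝ ∞ g V) (h0 : ∀ z ∈ V, g z ≠ 0) : ContDiffOn ℝ ∞ (fun z => f z / g z) V := by
  simp only [div_eq_mul_inv]
  exact hf.mul (hg.inv h0)

theorem contDiffOn_lineCoeff {v w : ℂ → C3} {V : Set ℂ} (hv : ContDiffOn ℝ ∞ v V)
    (hw : ContDiffOn ℝ ∞ w V) (hv0 : ∀ z ∈ V, v z ≠ 0) :
    ContDiffOn ℝ ∞ (fun z => lineCoeff (v z) (w z)) V :=
  (hv.inner ℂ hw).complex_div (hv.inner ℂ hv) (fun z hz => by simpa using hv0 z hz)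

theorem contDiffOn_tangentVec {F : ℂ → C3} {V : Set ℂ} (hV : IsOpen V) (hF : ContDiffOn ℝ ∞ F V)
    (hF0 : ∀ z ∈ V, F z ≠ 0) (X : ℂ) : ContDiffOn ℝ ∞ (tangentVec F X) V :=
  (hF.fderiv_apply_const hV X).sub
    ((contDiffOn_lineCoeff hF (hF.fderiv_apply_const hV X) hF0).smul hF)

/-- A smooth local lift of a conformal minimal Lagrangian immersion. -/
structure IsMinimalLagrangianLift (F : ℂ → C3) (f : ℂ → CP2) (V : Set ℂ) : Prop where
  isLocalLift : IsLocalLift F f V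
  conformal : ∀ z ∈ V, IsConformalImmersionAt F z
  lagrangian : ∀ z ∈ V, IsLagrangianAt F z
  minimal : ∀ z ∈ V, IsMinimalAt F z

namespace IsMinimalLagrangianLift

variable {F : ℂ → C3} {f : ℂ → CP2} {V : Set ℂ}

theorem ne_zero (h : IsMinimalLagrangianLift F f V) {z : ℂ} (hz : z ∈ V) : F z ≠ 0 :=
  (h.isLocalLift.lift z hz).1

theorem differentiableAt (h : IsMinimalLagrangianLift F f V) {z : ℂ} (hz : z ∈ V) :
    DifferentiableAt ℝ F z :=
  h.isLocalLift.smooth.differentiableAt_of_mem h.isLocalLift.isOpen hz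

theorem mono (h : IsMinimalLagrangianLift F f V) {W : Set ℂ} (hW : IsOpen W) (hWV : W ⊆ V) :
    IsMinimalLagrangianLift F f W :=
  ⟨⟨hW, h.isLocalLift.smooth.mono hWV, fun z hz => h.isLocalLift.lift z (hWV hz)⟩,
    fun z hz => h.conformal z (hWV hz), fun z hz => h.lagrangian z (hWV hz),
    fun z hz => h.minimal z (hWV hz)⟩

/-- The derivative of `l` occurs once in the derivative of the tangent vector and once in the
connection of the line, and the two cancel because the connection lives on `Hom(L, L^⊥)`. -/
theorem secondDeriv_smul (h : IsMinimalLagrangianLift F f V) {l : ℂ → ℂ}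
    (hl : ContDiffOn ℝ ∞ l V) (hl0 : ∀ z ∈ V, l z ≠ 0) {z : ℂ} (hz : z ∈ V) (X Y : ℂ) :
    secondDeriv (fun z => l z • F z) X Y z = l z • secondDeriv F X Y z := by
  have hV := h.isLocalLift.isOpen
  have dl : ∀ w ∈ V, DifferentiableAt ℝ l w := fun w hw => hl.differentiableAt_of_mem hV hw
  have hT : tangentVec (fun z => l z • F z) Y =ᶠ[𝓝 z] fun z => l z • tangentVec F Y z := by
    filter_upwards [hV.mem_nhds hz] with w hw
    exact tangentVec_smul (dl w hw) (h.differentiableAt hw) (hl0 w hw) (h.ne_zero hw) Y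
  have dT : DifferentiableAt ℝ (tangentVec F Y) z :=
    (contDiffOn_tangentVec hV h.isLocalLift.smooth (fun _ => h.ne_zero) Y).differentiableAt_of_mem
      hV hz
  have hF0 := h.ne_zero hz
  have hlz := hl0 z hz
  have hc : lineCoeff (F z) (l z • fderiv ℝ F z X + fderiv ℝ l z X • F z) =
      l z * lineCoeff (F z) (fderiv ℝ F z X) + fderiv ℝ l z X := by
    have : inner ℂ (F z) (F z) ≠ 0 := by simpa using hF0
    simp only [lineCoeff, inner_add_right, inner_smul_right]
    field_simp
  rw [secondDeriv, covDeriv, hT.fderiv_eq, fderiv_smul_apply (dl z hz) dT, hT.self_of_nhds,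
    fderiv_smul_apply (dl z hz) (h.differentiableAt hz), horPart_smul_left _ _ hlz,
    lineCoeff_smul_left _ _ hlz, hc, horPart_add, horPart_smul, horPart_smul,
    horPart_eq_self (w := tangentVec F Y z) (inner_horPart hF0 _), secondDeriv, covDeriv]
  match_scalars
  · field_simp
  · field_simp
    ring

theorem smul (h : IsMinimalLagrangianLift F f V) {l : ℂ → ℂ}
    (hl : ContDiffOn ℝ ∞ l V) (hl0 : ∀ z ∈ V, l z ≠ 0) :
    IsMinimalLagrangianLift (fun z => l z • F z) f V := by
  have hV := h.isLocalLift.isOpen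
  have dl : ∀ w ∈ V, DifferentiableAt ℝ l w := fun w hw => hl.differentiableAt_of_mem hV hw
  have hH : ∀ z ∈ V, ∀ X Y, fsHermitian (fun z => l z • F z) z X Y = fsHermitian F z X Y :=
    fun z hz => fsHermitian_smul (dl z hz) (h.differentiableAt hz) (hl0 z hz) (h.ne_zero hz)
  have hM : ∀ z ∈ V, ∀ X Y, inducedMetric (fun z => l z • F z) z X Y = inducedMetric F z X Y :=
    fun z hz X Y => by rw [inducedMetric, hH z hz, inducedMetric]
  refine ⟨⟨hV, hl.smul h.isLocalLift.smooth, fun z hz => ?_⟩, fun z hz => ?_, fun z hz X Y => ?_,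
    fun z hz ν h1 h2 => ?_⟩
  · exact IsRep.smul (h.isLocalLift.lift z hz) (hl0 z hz)
  · have := h.conformal z hz
    rwa [IsConformalImmersionAt, ← hM z hz, ← hM z hz, ← hM z hz] at this
  · have := h.lagrangian z hz X Y
    rwa [inducedKahlerForm, ← hH z hz] at this
  · have htr : metricTrace (fun z => l z • F z) z = l z • metricTrace F z := by
      simp only [metricTrace, hM z hz, h.secondDeriv_smul hl hl0 hz]
      match_scalars <;> ring
    have hlz : (starRingEnd ℂ) (l z) ≠ 0 := by simpa using hl0 z hz
    -- Multiplication by `l̄` carries normal vectors for `l F` to normal vectors for `F`, since `⟨l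
    -- a, ν⟩ = ⟨a, l̄ ν⟩`.
    have h3 := h.minimal z hz ((starRingEnd ℂ) (l z) • ν) (by
      rw [inner_smul_left] at h1
      rw [inner_smul_right]; exact h1) (by
      intro X
      have := h2 X
      rw [tangentVec_smul (dl z hz) (h.differentiableAt hz) (hl0 z hz) (h.ne_zero hz),
        inner_smul_left] at this
      rwa [inner_smul_right])
    rw [htr, inner_smul_left]
    rwa [inner_smul_right] at h3

theorem exists_unit (h : IsMinimalLagrangianLift F f V) :
    ∃ G, IsMinimalLagrangianLift G f V ∧ ∀ z ∈ V, ‖G z‖ = 1 := by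
  have hn : ∀ z ∈ V, ‖F z‖ ≠ 0 := fun z hz => norm_ne_zero_iff.2 (h.ne_zero hz)
  have hs : ContDiffOn ℝ ∞ (fun z => ‖F z‖) V :=
    h.isLocalLift.smooth.norm ℝ (fun z hz => h.ne_zero hz)
  refine ⟨fun z => (((‖F z‖)⁻¹ : ℝ) : ℂ) • F z, h.smul (l := fun z => (((‖F z‖)⁻¹ : ℝ) : ℂ)) ?_ ?_,
    fun z hz => ?_⟩
  · exact Complex.ofRealCLM.contDiff.comp_contDiffOn (hs.inv hn)
  · exact fun z hz => Complex.ofReal_ne_zero.2 (inv_ne_zero (hn z hz))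
  · rw [norm_smul, Complex.norm_real, norm_inv, norm_norm, inv_mul_cancel₀ (hn z hz)]

/-- Conformality and the Lagrangian condition make the two tangent vectors Hermitian orthogonal of
equal length, so `T_I = κ (F × T_1)` with `|κ| = 1`. Rescaling by `l` with `l³ κ = 1` removes this
phase. -/
theorem exists_normalized (h : IsMinimalLagrangianLift F f V) (h1 : ∀ z ∈ V, ‖F z‖ = 1) {p : ℂ}
    (hp : p ∈ V) : ∃ (W : Set ℂ) (G : ℂ → C3), p ∈ W ∧ W ⊆ V ∧ IsMinimalLagrangianLift G f W ∧
      (∀ z ∈ W, ‖G z‖ = 1) ∧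
      ∀ z ∈ W, tangentVec G Complex.I z = jc (G z) (tangentVec G 1 z) := by
  have hV := h.isLocalLift.isOpen
  have hT := contDiffOn_tangentVec hV h.isLocalLift.smooth (fun _ => h.ne_zero)
  have hH : ∀ z ∈ V, ∀ X Y, fsHermitian F z X Y =
      inner ℂ (tangentVec F X z) (tangentVec F Y z) := fun z hz X Y => by
    rw [fsHermitian, h1 z hz]; simp
  set κ : ℂ → ℂ := fun z => inner ℂ (jc (F z) (tangentVec F 1 z)) (tangentVec F Complex.I z) /
    inner ℂ (tangentVec F 1 z) (tangentVec F 1 z) with hκ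
  have hT0 : ∀ z ∈ V, tangentVec F 1 z ≠ 0 := by
    intro z hz h0
    have := (h.conformal z hz).1
    rw [inducedMetric, hH z hz, h0] at this
    simp at this
  have hFT : ∀ z ∈ V, ∀ X, inner ℂ (F z) (tangentVec F X z) = 0 := fun z hz X =>
    inner_horPart (h.ne_zero hz) _
  have hκs : ContDiffOn ℝ ∞ κ V := by
    refine ((h.isLocalLift.smooth.jc (hT 1)).inner ℂ (hT _)).complex_div ((hT 1).inner ℂ (hT 1)) ?_
    intro z hz
    simpa using hT0 z hz
  have hκT : ∀ z ∈ V, tangentVec F Complex.I z = κ z • jc (F z) (tangentVec F 1 z) := by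
    intro z hz
    have e := C3.expand (h1 z hz) (hT0 z hz) (hFT z hz 1) (tangentVec F Complex.I z)
    have h12 : inner ℂ (tangentVec F 1 z) (tangentVec F Complex.I z) = 0 := by
      apply Complex.ext
      · have := (h.conformal z hz).2.2
        rwa [inducedMetric, hH z hz] at this
      · have := h.lagrangian z hz 1 Complex.I
        rwa [inducedKahlerForm, hH z hz] at this
    rw [hFT z hz, h12, zero_smul, zero_div, zero_smul, zero_add, zero_add] at e
    rw [e, hκ]
    simp only [← e]
    rw [inner_self_eq_norm_sq_to_K]; norm_cast
  have hκ1 : ∀ z ∈ V, ‖κ z‖ = 1 := by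
    intro z hz
    have e := congrArg norm (hκT z hz)
    rw [norm_smul, norm_jc_of_inner_eq_zero (hFT z hz 1), h1 z hz, one_mul] at e
    have e2 := (h.conformal z hz).2.1
    rw [inducedMetric, inducedMetric, hH z hz, hH z hz, inner_self_eq_norm_sq_to_K,
      inner_self_eq_norm_sq_to_K] at e2
    have e3 : ‖tangentVec F 1 z‖ ^ 2 = ‖tangentVec F Complex.I z‖ ^ 2 := by
      simp only [Complex.coe_algebraMap, ← Complex.ofReal_pow, Complex.ofReal_re] at e2
      exact e2
    have e4 := (sq_eq_sq₀ (norm_nonneg _) (norm_nonneg _)).1 e3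
    rw [← e4] at e
    have := norm_ne_zero_iff.2 (hT0 z hz)
    exact mul_right_cancel₀ this (by rw [← e, one_mul])
  have hκ0 : ∀ z ∈ V, κ z ≠ 0 := fun z hz => by rw [← norm_ne_zero_iff, hκ1 z hz]; simp
  obtain ⟨μ, hμ⟩ := IsAlgClosed.exists_pow_nat_eq (κ p)⁻¹ (n := 3) (by norm_num)
  have hμ0 : μ ≠ 0 := by
    intro h0
    rw [h0] at hμ
    exact inv_ne_zero (hκ0 p hp) (by rw [← hμ]; simp)
  set W := V ∩ (fun z => κ z / κ p) ⁻¹' Complex.slitPlane with hW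
  have hWo : IsOpen W :=
    (hκs.continuousOn.div_const _).isOpen_inter_preimage hV Complex.isOpen_slitPlane
  have hWV : W ⊆ V := Set.inter_subset_left
  have hpW : p ∈ W := ⟨hp, by simp [div_self (hκ0 p hp)]⟩
  -- A smooth branch of `κ^(-1/3)` near `p`: dividing by `κ p` keeps the argument of the logarithm
  -- in the slit plane, and `μ` restores the factor, as `μ³ = (κ p)⁻¹`.
  set l : ℂ → ℂ := fun z => μ * Complex.exp (-(Complex.log (κ z / κ p) / 3)) with hl
  have hl0 : ∀ z, l z ≠ 0 := fun z => mul_ne_zero hμ0 (Complex.exp_ne_zero _)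
  have hl3 : ∀ z ∈ W, l z ^ 3 * κ z = 1 := by
    intro z hz
    have hne : κ z / κ p ≠ 0 := div_ne_zero (hκ0 z (hWV hz)) (hκ0 p hp)
    simp only [hl]
    rw [mul_pow, ← Complex.exp_nat_mul, hμ]
    have : ((3 : ℕ) : ℂ) * -(Complex.log (κ z / κ p) / 3) = -Complex.log (κ z / κ p) := by
      push_cast; ring
    rw [this, Complex.exp_neg, Complex.exp_log hne]
    have := hκ0 z (hWV hz)
    have := hκ0 p hp
    field_simp
  have hl1 : ∀ z ∈ W, ‖l z‖ = 1 := by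
    intro z hz
    have := congrArg norm (hl3 z hz)
    rw [norm_mul, norm_pow, hκ1 z (hWV hz), mul_one, norm_one] at this
    exact (pow_eq_one_iff_of_nonneg (norm_nonneg _) (by norm_num)).1 this
  have hls : ContDiffOn ℝ ∞ l W := by
    have hlog : ContDiffOn ℝ ∞ (fun z => Complex.log (κ z / κ p)) W := by
      intro z hz
      have e1 : ContDiffAt ℝ ∞ Complex.log (κ z / κ p) :=
        (Complex.contDiffAt_log hz.2).restrict_scalars ℝ
      exact e1.comp_contDiffWithinAt z
        (((hκs.mono hWV).div_const _) z hz)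
    have hexp : ContDiff ℝ ∞ Complex.exp := Complex.contDiff_exp
    exact contDiffOn_const.mul (hexp.comp_contDiffOn (hlog.div_const 3).neg)
  refine ⟨W, fun z => l z • F z, hpW, hWV, (h.mono hWo hWV).smul hls (fun z _ => hl0 z),
    fun z hz => by rw [norm_smul, hl1 z hz, h1 z (hWV hz), one_mul], fun z hz => ?_⟩
  have dl := hls.differentiableAt_of_mem hWo hz
  rw [tangentVec_smul dl (h.differentiableAt (hWV hz)) (hl0 z) (h.ne_zero (hWV hz)),
    tangentVec_smul dl (h.differentiableAt (hWV hz)) (hl0 z) (h.ne_zero (hWV hz)),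
    hκT z (hWV hz), jc_smul_left, jc_smul_right, smul_smul, smul_smul]
  congr 1
  have h5 : star (l z) * l z = 1 := by
    simp [RCLike.star_def, Complex.conj_mul', hl1 z hz]
  linear_combination star (l z) ^ 2 * hl3 z hz - l z * κ z * (star (l z) * l z + 1) * h5

/-- The vertical part of `dF` is a form `a = ⟨F, dF⟩`, imaginary because `‖F‖ = 1`. With the phase
normalized, the mean curvature in the normal directions `I • T_k` is proportional to `a`, so
minimality gives `a = 0`. -/
theorem isSpecialAt_of_normalized (h : IsMinimalLagrangianLift F f V) (h1 : ∀ z ∈ V, ‖F z‖ = 1)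
    (hI : ∀ z ∈ V, tangentVec F Complex.I z = jc (F z) (tangentVec F 1 z)) {z : ℂ} (hz : z ∈ V) :
    IsSpecialAt F z := by
  have hV := h.isLocalLift.isOpen
  have hFs := h.isLocalLift.smooth
  have hnhds := hV.mem_nhds hz
  have hT := contDiffOn_tangentVec hV hFs (fun _ => h.ne_zero)
  have dT : ∀ X, DifferentiableAt ℝ (tangentVec F X) z := fun X => (hT X).differentiableAt_of_mem hV hz
  have dF : DifferentiableAt ℝ F z := h.differentiableAt hz
  have hH : ∀ X Y, fsHermitian F z X Y =
      inner ℂ (tangentVec F X z) (tangentVec F Y z) := fun X Y => by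
    rw [fsHermitian, h1 z hz]; simp
  have hFF : inner ℂ (F z) (F z) = 1 := by rw [inner_self_eq_norm_sq_to_K, h1 z hz]; simp
  have hFT : ∀ X, inner ℂ (F z) (tangentVec F X z) = 0 := fun X => inner_horPart (h.ne_zero hz) _
  have hTF : ∀ X, inner ℂ (tangentVec F X z) (F z) = 0 := fun X => by
    rw [← inner_conj_symm, hFT, map_zero]
  have hT0 : tangentVec F 1 z ≠ 0 := by
    intro h0
    have := (h.conformal z hz).1
    rw [inducedMetric, hH, h0] at this
    simp at this
  set a : ℂ → ℂ := fun X => lineCoeff (F z) (fderiv ℝ F z X) with ha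
  have haF : ∀ X, a X = inner ℂ (F z) (fderiv ℝ F z X) := fun X => by
    simp only [ha, lineCoeff, hFF, div_one]
  have hdF : ∀ X, fderiv ℝ F z X = tangentVec F X z + a X • F z := fun X => by
    rw [tangentVec, horPart, sub_add_cancel]
  set ρ : ℝ := ‖tangentVec F 1 z‖ ^ 2 with hρ
  have hρ0 : 0 < ρ := by
    have := norm_pos_iff.2 hT0
    positivity
  have i11 : inner ℂ (tangentVec F 1 z) (tangentVec F 1 z) = (ρ : ℂ) := by
    rw [inner_self_eq_norm_sq_to_K, hρ]; norm_cast
  have i1I : inner ℂ (tangentVec F 1 z) (tangentVec F Complex.I z) = 0 := by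
    rw [hI z hz, inner_jc_right]
  have iI1 : inner ℂ (tangentVec F Complex.I z) (tangentVec F 1 z) = 0 := by
    rw [← inner_conj_symm, i1I, map_zero]
  have iII : inner ℂ (tangentVec F Complex.I z) (tangentVec F Complex.I z) = (ρ : ℂ) := by
    rw [hI z hz, inner_jc_jc, hFF, i11, hFT]; simp
  have ha_re : ∀ X, (a X).re = 0 := by
    intro X
    have e : (fun w => inner ℂ (F w) (F w)) =ᶠ[𝓝 z] fun _ => (1 : ℂ) := by
      filter_upwards [hnhds] with w hw
      rw [inner_self_eq_norm_sq_to_K, h1 w hw]; simp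
    have e2 := fderiv_inner_apply ℂ dF dF X
    rw [e.fderiv_eq, ← inner_conj_symm (fderiv ℝ F z X), ← haF] at e2
    have := congrArg Complex.re e2
    simp at this
    linarith
  set d : ℂ → ℂ → C3 := fun X Y => fderiv ℝ (tangentVec F Y) z X with hd
  have hsec : ∀ X Y, secondDeriv F X Y z = horPart (F z) (d X Y) - a X • tangentVec F Y z :=
    fun X Y => rfl
  have hThor : ∀ X w, inner ℂ (tangentVec F X z) (horPart (F z) w) =
      inner ℂ (tangentVec F X z) w := by
    intro X w
    rw [horPart, inner_sub_right, inner_smul_right, hTF, mul_zero, sub_zero]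
  have hmin : ∀ k, (inner ℂ (tangentVec F k z) (secondDeriv F 1 1 z)
      + inner ℂ (tangentVec F k z) (secondDeriv F Complex.I Complex.I z)).im = 0 := by
    intro k
    -- For a Lagrangian surface the complex structure maps tangent vectors to normal vectors.
    have e := h.minimal z hz (Complex.I • tangentVec F k z)
      (by rw [inner_smul_right, hFT, mul_zero]) (by
        intro X
        have := h.lagrangian z hz X k
        rw [inducedKahlerForm, hH] at this
        rw [inner_smul_right]
        simp [this])
    have m11 : inducedMetric F z 1 1 = ρ := by rw [inducedMetric, hH, i11, Complex.ofReal_re]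
    have mII : inducedMetric F z Complex.I Complex.I = ρ := by
      rw [inducedMetric, hH, iII, Complex.ofReal_re]
    have m1I : inducedMetric F z 1 Complex.I = 0 := by
      rw [inducedMetric, hH, i1I, Complex.zero_re]
    rw [metricTrace, m11, mII, m1I, zero_smul, zero_smul, sub_zero, sub_zero, ← smul_add,
      inner_smul_right, RCLike.real_smul_eq_coe_smul (K := ℂ), inner_smul_left,
      inner_add_left] at e
    simp [hρ0.ne'] at e
    rw [← inner_conj_symm _ (secondDeriv F 1 1 z), ← inner_conj_symm _ (secondDeriv F Complex.I _ z)]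
    simp only [Complex.add_im, Complex.conj_im]
    linarith
  have hanti : ∀ X, inner ℂ (tangentVec F 1 z) (d X Complex.I)
      + inner ℂ (d X 1) (tangentVec F Complex.I z) = 0 := by
    intro X
    have e : (fun w => inner ℂ (tangentVec F 1 w) (tangentVec F Complex.I w)) =ᶠ[𝓝 z]
        fun _ => (0 : ℂ) := by
      filter_upwards [hnhds] with w hw
      rw [hI w hw, inner_jc_right]
    have e2 := fderiv_inner_apply ℂ (dT 1) (dT Complex.I) X
    rw [e.fderiv_eq] at e2
    simpa using e2.symm
  -- Symmetry of second derivatives of `F`. The component along `F` is irrelevant, because only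
  -- products with tangent vectors are taken below.
  have hsymm : ∃ c : ℂ, d Complex.I 1 - d 1 Complex.I =
      c • F z - a 1 • fderiv ℝ F z Complex.I + a Complex.I • fderiv ℝ F z 1 := by
    have hdiff : ∀ Y, DifferentiableAt ℝ (fun w => lineCoeff (F w) (fderiv ℝ F w Y)) z := fun Y =>
      (contDiffOn_lineCoeff hFs (hFs.fderiv_apply_const hV Y)
        (fun _ => h.ne_zero)).differentiableAt_of_mem hV hz
    have hd2 : ∀ Y, DifferentiableAt ℝ (fun w => fderiv ℝ F w Y) z := fun Y =>
      (hFs.fderiv_apply_const hV Y).differentiableAt_of_mem hV hz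
    have e : ∀ X Y, d X Y = fderiv ℝ (fun w => fderiv ℝ F w Y) z X
        - (a Y • fderiv ℝ F z X
          + fderiv ℝ (fun w => lineCoeff (F w) (fderiv ℝ F w Y)) z X • F z) := by
      intro X Y
      have e1 : tangentVec F Y = fun w => fderiv ℝ F w Y
          - lineCoeff (F w) (fderiv ℝ F w Y) • F w := rfl
      simp only [hd]
      rw [e1, fderiv_fun_sub (hd2 Y) ((hdiff Y).fun_smul dF), sub_apply,
        fderiv_smul_apply (hdiff Y) dF]
    refine ⟨fderiv ℝ (fun w => lineCoeff (F w) (fderiv ℝ F w Complex.I)) z 1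
      - fderiv ℝ (fun w => lineCoeff (F w) (fderiv ℝ F w 1)) z Complex.I, ?_⟩
    rw [e, e, fderiv_fderiv_apply_comm hV hFs hz Complex.I 1]
    module
  have hjc : ∀ X, d X Complex.I = jc (F z) (d X 1) + jc (fderiv ℝ F z X) (tangentVec F 1 z) := by
    intro X
    have e : tangentVec F Complex.I =ᶠ[𝓝 z] fun w => jc (F w) (tangentVec F 1 w) := by
      filter_upwards [hnhds] with w hw using hI w hw
    simp only [hd]
    rw [e.fderiv_eq, fderiv_jc dF (dT 1)]
  have hII : ∀ X, inner ℂ (tangentVec F Complex.I z) (d X Complex.I) =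
      inner ℂ (d X 1) (tangentVec F 1 z) + (starRingEnd ℂ) (a X) * ρ := by
    intro X
    rw [hjc, hI z hz, inner_add_right, inner_jc_jc, inner_jc_jc, hFF, hFT, i11, hTF, haF,
      inner_conj_symm]
    ring
  obtain ⟨c, hc⟩ := hsymm
  have s1 : inner ℂ (tangentVec F Complex.I z) (d Complex.I 1) =
      inner ℂ (tangentVec F Complex.I z) (d 1 Complex.I) - a 1 * ρ := by
    have := congrArg (inner ℂ (tangentVec F Complex.I z)) hc
    rw [hdF, hdF] at this
    simp only [inner_sub_right, inner_add_right, inner_smul_right, hTF, iI1, iII] at this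
    linear_combination this
  have s2 : inner ℂ (tangentVec F 1 z) (d 1 Complex.I) =
      inner ℂ (tangentVec F 1 z) (d Complex.I 1) - a Complex.I * ρ := by
    have := congrArg (inner ℂ (tangentVec F 1 z)) hc
    rw [hdF, hdF] at this
    simp only [inner_sub_right, inner_add_right, inner_smul_right, hTF, i1I, i11] at this
    linear_combination -this
  have hflip : ∀ v w : C3, (inner ℂ v w).im = -(inner ℂ w v).im := fun v w => by
    rw [← inner_conj_symm w v, Complex.conj_im, neg_neg]
  have E1 := hmin 1
  have EI := hmin Complex.I
  simp only [hsec, inner_sub_right, hThor, inner_smul_right, i11, i1I, iI1, iII, mul_zero, sub_zero]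
    at E1 EI
  have A1 := congrArg Complex.im (hanti Complex.I)
  have A2 := congrArg Complex.im (hanti 1)
  have B1 := congrArg Complex.im (hII 1)
  have B2 := congrArg Complex.im (hII Complex.I)
  have S1 := congrArg Complex.im s1
  have S2 := congrArg Complex.im s2
  have c1 := hflip (tangentVec F 1 z) (d 1 1)
  have c2 := hflip (tangentVec F Complex.I z) (d Complex.I 1)
  have c3 := hflip (tangentVec F 1 z) (d Complex.I 1)
  have c4 := hflip (tangentVec F Complex.I z) (d 1 1)
  simp only [Complex.add_im, Complex.sub_im, Complex.mul_im, Complex.ofReal_re, Complex.ofReal_im,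
    Complex.conj_im, Complex.conj_re, mul_zero, zero_add, Complex.zero_im, ha_re] at E1 EI A1 A2 B1 B2 S1 S2
  -- Substitution cancels all second derivatives in the minimality equation, and what remains is `-3
  -- ρ Im a(1) = 0`; the other direction is analogous.
  have hone : (a 1).im = 0 := by
    have : (a 1).im * ρ = 0 := by linarith
    exact (mul_eq_zero.1 this).resolve_right hρ0.ne'
  have hI0 : (a Complex.I).im = 0 := by
    have : (a Complex.I).im * ρ = 0 := by linarith
    exact (mul_eq_zero.1 this).resolve_right hρ0.ne'
  have a1 : a 1 = 0 := Complex.ext (ha_re 1) hone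
  have aI : a Complex.I = 0 := Complex.ext (ha_re _) hI0
  have e1 : fderiv ℝ F z 1 = tangentVec F 1 z := by rw [hdF, a1, zero_smul, add_zero]
  have eI : fderiv ℝ F z Complex.I = tangentVec F Complex.I z := by rw [hdF, aI, zero_smul, add_zero]
  exact IsSpecialAt.of_fderiv_one (h1 z hz) (by rw [e1, hFT]) (by rw [e1, eI, hI z hz])
    (by rwa [e1])

end IsMinimalLagrangianLift

theorem IsMinimalLagrangianImmersion.exists_special {f : ℂ → CP2} {U : Set ℂ}
    (h : IsMinimalLagrangianImmersion f U) {p : ℂ} (hp : p ∈ U) :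
    ∃ (V : Set ℂ) (F : ℂ → C3), p ∈ V ∧ V ⊆ U ∧ IsSpecialOn F V ∧ IsLiftOn F f V := by
  obtain ⟨V, F, hpV, hVU, hl, hc⟩ := h p hp
  have h0 : IsMinimalLagrangianLift F f V :=
    ⟨hl, fun z hz => (hc z hz).1, fun z hz => (hc z hz).2.1, fun z hz => (hc z hz).2.2⟩
  obtain ⟨G, hG, hG1⟩ := h0.exists_unit
  obtain ⟨W, H, hpW, hWV, hH, hH1, hHI⟩ := hG.exists_normalized hG1 hpV
  exact ⟨W, H, hpW, hWV.trans hVU, ⟨hH.isLocalLift.isOpen, hH.isLocalLift.smooth,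
    fun z hz => hH.isSpecialAt_of_normalized hH1 hHI hz⟩, hH.isLocalLift.lift⟩

/-! ### One-parameter groups of special unitary maps -/

/-- The Lie algebra condition corresponding to `IsSU`. -/
structure IsInfinitesimalSU (A : C3 →L[ℂ] C3) : Prop where
  skew : ∀ a b, inner ℂ (A a) b + inner ℂ a (A b) = 0
  map_jc : ∀ a b, A (jc a b) = jc a (A b) + jc (A a) b

/-- The one-parameter group generated by `A`. -/
def flow (A : C3 →L[ℂ] C3) (t : ℝ) : C3 →L[ℂ] C3 := NormedSpace.exp (t • A)

@[simp] theorem flow_zero (A : C3 →L[ℂ] C3) : flow A 0 = 1 := by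
  rw [flow, show (0 : ℝ) • A = 0 from zero_smul ℝ A, NormedSpace.exp_zero]

theorem flow_zero_apply (A : C3 →L[ℂ] C3) (v : C3) : flow A 0 v = v := by rw [flow_zero]; rfl

theorem flow_add (A : C3 →L[ℂ] C3) (s t : ℝ) : flow A (s + t) = flow A s * flow A t := by
  let _ : NormedAlgebra ℚ (C3 →L[ℂ] C3) := NormedAlgebra.restrictScalars ℚ ℂ _
  have hc : Commute (s • A) (t • A) := by
    ext1 v
    change s • A (t • A v) = t • A (s • A v)
    rw [A.map_smul_of_tower, A.map_smul_of_tower, smul_comm]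
  rw [flow, show (s + t) • A = s • A + t • A from add_smul s t A,
    NormedSpace.exp_add_of_commute hc]
  rfl

theorem flow_add_apply (A : C3 →L[ℂ] C3) (s t : ℝ) (v : C3) :
    flow A (s + t) v = flow A s (flow A t v) := by rw [flow_add]; rfl

theorem hasDerivAt_flow (A : C3 →L[ℂ] C3) (t : ℝ) : HasDerivAt (flow A) (A * flow A t) t :=
  hasDerivAt_exp_smul_const' A t

theorem hasDerivAt_flow' (A : C3 →L[ℂ] C3) (t : ℝ) : HasDerivAt (flow A) (flow A t * A) t :=
  hasDerivAt_exp_smul_const A t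

theorem flow_comm (A : C3 →L[ℂ] C3) (t : ℝ) (v : C3) : flow A t (A v) = A (flow A t v) := by
  have := (hasDerivAt_flow A t).unique (hasDerivAt_flow' A t)
  exact (congrArg (fun B : C3 →L[ℂ] C3 => B v) this).symm

theorem hasDerivAt_flow_apply (A : C3 →L[ℂ] C3) (v : C3) (t : ℝ) :
    HasDerivAt (fun t => flow A t v) (A (flow A t v)) t := by
  have h := ((ContinuousLinearMap.apply ℂ C3 v).restrictScalars ℝ).hasFDerivAt.comp_hasDerivAt t
    (hasDerivAt_flow A t)
  exact h

theorem contDiff_flow (A : C3 →L[ℂ] C3) : ContDiff ℝ ∞ (flow A) := by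
  have hd : deriv (flow A) = fun t => A * flow A t := funext fun t => (hasDerivAt_flow A t).deriv
  rw [contDiff_infty]
  intro n
  induction n with
  | zero =>
    exact contDiff_zero.2 (continuous_iff_continuousAt.2 fun t => (hasDerivAt_flow A t).continuousAt)
  | succ n ih =>
    have e : ((n + 1 : ℕ) : WithTop ℕ∞) = (n : WithTop ℕ∞) + 1 := by push_cast; rfl
    refine e ▸ contDiff_succ_iff_deriv.2 ⟨fun t => (hasDerivAt_flow A t).differentiableAt, by simp, ?_⟩
    rw [hd]
    exact contDiff_const.mul ih

/-- The difference `e` from the flow satisfies `e' = A e`, so `‖e‖²` is constant by skewness, and it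
vanishes at `0`. -/
theorem IsInfinitesimalSU.eqOn_flow {A : C3 →L[ℂ] C3} (hA : IsInfinitesimalSU A) {w : ℝ → C3}
    {s : Set ℝ} (hs : IsOpen s) (hs' : IsPreconnected s) (h0 : (0 : ℝ) ∈ s)
    (hw : ∀ t ∈ s, HasDerivAt w (A (w t)) t) : ∀ t ∈ s, w t = flow A t (w 0) := by
  intro t ht
  set e : ℝ → C3 := fun t => w t - flow A t (w 0) with he
  have hd : ∀ t ∈ s, HasDerivAt (fun t => inner ℂ (e t) (e t)) 0 t := by
    intro t ht
    have h1 : HasDerivAt e (A (e t)) t := by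
      have := (hw t ht).sub (hasDerivAt_flow_apply A (w 0) t)
      rwa [← map_sub] at this
    have h2 := h1.inner ℂ h1
    rwa [add_comm, hA.skew] at h2
  have := hs.is_const_of_deriv_eq_zero hs'
    (fun t ht => (hd t ht).differentiableAt.differentiableWithinAt)
    (fun t ht => (hd t ht).deriv) ht h0
  have e0 : e 0 = 0 := by simp [he]
  rw [e0, inner_zero_left] at this
  exact sub_eq_zero.1 (inner_self_eq_zero.1 this)

/-- Skewness makes inner products constant along the flow. As `A` is a derivation of `jc`, the
product of two flow lines solves the same linear equation and is itself a flow line. -/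
theorem IsInfinitesimalSU.isSU_flow {A : C3 →L[ℂ] C3} (hA : IsInfinitesimalSU A) (t : ℝ) :
    IsSU (flow A t) := by
  refine ⟨fun a b => ?_, fun a b => ?_⟩
  · have hd : ∀ t, HasDerivAt (fun t => inner ℂ (flow A t a) (flow A t b)) 0 t := by
      intro t
      have h2 := (hasDerivAt_flow_apply A a t).inner ℂ (hasDerivAt_flow_apply A b t)
      rwa [add_comm, hA.skew] at h2
    have := is_const_of_deriv_eq_zero (fun t => (hd t).differentiableAt) (fun t => (hd t).deriv) t 0
    simpa using this
  · have := hA.eqOn_flow isOpen_univ isPreconnected_univ (Set.mem_univ 0)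
      (w := fun t => jc (flow A t a) (flow A t b)) (fun t _ => by
        rw [hA.map_jc]
        exact (hasDerivAt_flow_apply A a t).jc (hasDerivAt_flow_apply A b t)) t (Set.mem_univ t)
    simpa using this.symm

theorem norm_eq_one_of_cube {c : ℂ} (h : c ^ 3 = 1) : ‖c‖ = 1 := by
  have := congrArg norm h
  rw [norm_pow, norm_one] at this
  exact (pow_eq_one_iff_of_nonneg (norm_nonneg _) (by norm_num)).1 this

/-- Cube roots of unity are discrete: with `d = c - 1`, `c³ - 1 = d (3 + 3d + d²)` and the second
factor cannot vanish for `|d| < 1/2`. -/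
theorem eq_one_of_cube {c : ℂ} (h : c ^ 3 = 1) (hc : ‖c - 1‖ < 1 / 2) : c = 1 := by
  have h1 : (c - 1) * (3 + (3 * (c - 1) + (c - 1) ^ 2)) = 0 := by linear_combination h
  rcases mul_eq_zero.1 h1 with h2 | h2
  · exact sub_eq_zero.1 h2
  · exfalso
    have h3 : (3 : ℂ) = -(3 * (c - 1) + (c - 1) ^ 2) := eq_neg_of_add_eq_zero_left h2
    have h4 := congrArg norm h3
    rw [norm_neg] at h4
    have h5 := norm_add_le (3 * (c - 1)) ((c - 1) ^ 2)
    rw [← h4, norm_mul, norm_pow] at h5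
    norm_num at h5
    nlinarith [norm_nonneg (c - 1)]

/-! ### Symmetries of special lifts and their infinitesimal generator -/

theorem IsRep.exists_eq_smul {v w : C3} {p : CP2} (hv : IsRep v p) (hw : IsRep w p) :
    ∃ c : ℂ, v = c • w := let ⟨c, _, h⟩ := hv.exists_smul hw; ⟨c, h⟩

theorem IsSpecialOn.comp_add {F : ℂ → C3} {V W : Set ℂ} (h : IsSpecialOn F V) (t : ℂ)
    (hW : IsOpen W) (hmaps : ∀ w ∈ W, w + t ∈ V) : IsSpecialOn (fun w => F (w + t)) W :=
  h.comp (φ := fun w => w + t) (φ' := fun _ => 1) hW (contDiff_id.add contDiff_const).contDiffOn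
    hmaps (fun w _ => (hasDerivAt_id w).add_const t) (fun _ _ => one_ne_zero)

theorem add_mem_ball {w₀ w : ℂ} {t r s : ℝ} (hw : w ∈ Metric.ball w₀ s) (ht : |t| + s ≤ r) :
    w + t ∈ Metric.ball w₀ r := by
  rw [Metric.mem_ball, dist_eq_norm] at *
  calc ‖w + t - w₀‖ = ‖(w - w₀) + t‖ := by ring_nf
    _ ≤ ‖w - w₀‖ + ‖(t : ℂ)‖ := norm_add_le _ _
    _ < s + |t| := by rw [Complex.norm_real, Real.norm_eq_abs]; linarith
    _ ≤ r := by linarith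

theorem hasDerivAt_comp_add_real {F : ℂ → C3} {w : ℂ} {t : ℝ}
    (hF : DifferentiableAt ℝ F (w + t)) :
    HasDerivAt (fun t : ℝ => F (w + t)) (fderiv ℝ F (w + t) 1) t := by
  have h1 : HasDerivAt (fun t : ℝ => w + (t : ℂ)) 1 t := by
    simpa using (Complex.ofRealCLM.hasDerivAt (x := t)).const_add w
  exact hF.hasFDerivAt.comp_hasDerivAt t h1

/-- A translate of a special lift differs from its image under a special unitary map realizing the
symmetry by a cube root of unity. -/
theorem IsSpecialOn.exists_shift {F : ℂ → C3} {f₀ : ℂ → CP2} {w₀ : ℂ} {r t : ℝ} {T : CP2 → CP2}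
    {U : C3 →L[ℂ] C3}
    (hF : IsSpecialOn F (Metric.ball w₀ r)) (hl : IsLiftOn F f₀ (Metric.ball w₀ r))
    (hU : IsSU U) (hUT : ∀ v p, IsRep v p → IsRep (U v) (T p))
    (hf : ∀ w ∈ Metric.ball w₀ r, f₀ (w + t) = T (f₀ w)) (ht : |t| < r / 2) :
    ∃ c : ℂ, c ^ 3 = 1 ∧ ∀ w ∈ Metric.ball w₀ (r / 2), F (w + t) = c • U (F w) := by
  have hsub : Metric.ball w₀ (r / 2) ⊆ Metric.ball w₀ r :=
    Metric.ball_subset_ball (by linarith [abs_nonneg t])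
  have hadd : ∀ w ∈ Metric.ball w₀ (r / 2), w + t ∈ Metric.ball w₀ r := fun w hw =>
    add_mem_ball hw (by linarith)
  refine (hF.comp_add t Metric.isOpen_ball hadd).eq_smul
    ((hF.mono Metric.isOpen_ball hsub).map hU) (convex_ball _ _).isPreconnected fun w hw => ?_
  have h1 := hl _ (hadd w hw)
  rw [hf w (hsub hw)] at h1
  exact h1.exists_eq_smul (hUT _ _ (hl w (hsub hw)))

theorem fderiv_map_comp {F G : ℂ → C3} {U : C3 →L[ℂ] C3} {t : ℂ} {w : ℂ}
    (hF : DifferentiableAt ℝ F w)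
    (h : ∀ᶠ w in 𝓝 w, G (w + t) = U (F w)) (X : ℂ) :
    fderiv ℝ G (w + t) X = U (fderiv ℝ F w X) := by
  have e1 : fderiv ℝ (fun w => G (w + t)) w = fderiv ℝ G (w + t) := fderiv_comp_add_right t
  have h2 : (fun w => G (w + t)) =ᶠ[𝓝 w] (U.restrictScalars ℝ) ∘ F := h
  rw [← e1, h2.fderiv_eq,
    (((U.restrictScalars ℝ).hasFDerivAt (x := F w)).comp w hF.hasFDerivAt).fderiv]
  rfl

/-- A one-parameter group of isometries that preserves a minimal Lagrangian surface with special
lift `F` has an infinitesimal generator. -/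
theorem IsSpecialOn.exists_generator {F : ℂ → C3} {f₀ : ℂ → CP2} {w₀ : ℂ} {r : ℝ}
    {R : ℝ → Equiv.Perm CP2} (hr : 0 < r)
    (hF : IsSpecialOn F (Metric.ball w₀ r)) (hl : IsLiftOn F f₀ (Metric.ball w₀ r))
    (hR : IsOneParameterIsometryGroup R)
    (hf : ∀ t : ℝ, ∀ w ∈ Metric.ball w₀ r, f₀ (w + t) = R t (f₀ w)) :
    ∃ A : C3 →L[ℂ] C3, IsInfinitesimalSU A ∧
      ∀ t v p, IsRep v p → IsRep (flow A t v) (R t p) := by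
  have hw₀ : w₀ ∈ Metric.ball w₀ r := Metric.mem_ball_self hr
  have hs := hF.special w₀ hw₀
  have hdiff : ∀ w ∈ Metric.ball w₀ r, DifferentiableAt ℝ F w := fun w hw =>
    hF.smooth.differentiableAt_of_mem hF.isOpen hw
  have hdiff' : ∀ X, ∀ w ∈ Metric.ball w₀ r, DifferentiableAt ℝ (fun w => fderiv ℝ F w X) w :=
    fun X w hw => (hF.smooth.fderiv_apply_const hF.isOpen X).differentiableAt_of_mem hF.isOpen hw
  -- The cube root of unity from `exists_shift` is absorbed into the special unitary map, so that
  -- the lift is equivariant and not merely its projection.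
  have step1 : ∀ t : ℝ, |t| < r / 2 → ∃ U : C3 →L[ℂ] C3, IsSU U ∧
      (∀ v p, IsRep v p → IsRep (U v) (R t p)) ∧
      ∀ w ∈ Metric.ball w₀ (r / 2), F (w + t) = U (F w) := by
    intro t ht
    obtain ⟨U, hU, hUR⟩ := hR.exists_isSU t
    obtain ⟨c, hc, hcF⟩ := hF.exists_shift hl hU hUR (hf t) ht
    have hc1 := norm_eq_one_of_cube hc
    have hc0 : c ≠ 0 := by rw [← norm_ne_zero_iff, hc1]; simp
    exact ⟨c • U, hU.smul hc1 hc, fun v p hvp => (hUR v p hvp).smul hc0, hcF⟩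
  choose! U hU hUR hUF using step1
  set ρ : ℂ := ((‖fderiv ℝ F w₀ 1‖ ^ 2 : ℝ) : ℂ) with hρ
  have hexp := C3.expand hs.norm_eq hs.ne_zero (hs.horizontal 1)
  rw [← hs.fderiv_I] at hexp
  -- The maps `U t` are chosen separately for each `t`, with no continuity. But `U t` carries the
  -- frame `F, F_x, F_y` at `w₀` to the frame at `w₀ + t`, so `U t v` equals this expression, which
  -- is differentiable at `t = 0` with derivative `A v`.
  set u : C3 → ℝ → C3 := fun v t => inner ℂ (F w₀) v • F (w₀ + t)
    + (inner ℂ (fderiv ℝ F w₀ 1) v / ρ) • fderiv ℝ F (w₀ + t) 1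
    + (inner ℂ (fderiv ℝ F w₀ Complex.I) v / ρ) • fderiv ℝ F (w₀ + t) Complex.I with hu
  let A : C3 →L[ℂ] C3 := (innerSL ℂ (F w₀)).smulRight (fderiv ℝ F w₀ 1)
    + (ρ⁻¹ • innerSL ℂ (fderiv ℝ F w₀ 1)).smulRight (fderiv ℝ (fun w => fderiv ℝ F w 1) w₀ 1)
    + (ρ⁻¹ • innerSL ℂ (fderiv ℝ F w₀ Complex.I)).smulRight
        (fderiv ℝ (fun w => fderiv ℝ F w Complex.I) w₀ 1)
  have hA : ∀ v, A v = inner ℂ (F w₀) v • fderiv ℝ F w₀ 1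
    + (inner ℂ (fderiv ℝ F w₀ 1) v / ρ) • fderiv ℝ (fun w => fderiv ℝ F w 1) w₀ 1
    + (inner ℂ (fderiv ℝ F w₀ Complex.I) v / ρ) •
        fderiv ℝ (fun w => fderiv ℝ F w Complex.I) w₀ 1 := by
    intro v
    simp [A, div_eq_inv_mul]
  have hw₀0 : w₀ + ((0 : ℝ) : ℂ) = w₀ := by simp
  have hu0 : ∀ v, u v 0 = v := by
    intro v
    simp only [hu, hw₀0]
    exact (hexp v).symm
  have hud : ∀ v, HasDerivAt (u v) (A v) 0 := by
    intro v
    have d0 := hasDerivAt_comp_add_real (F := F) (w := w₀) (t := 0) (by rw [hw₀0]; exact hdiff _ hw₀)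
    have d1 : ∀ X, HasDerivAt (fun t : ℝ => fderiv ℝ F (w₀ + t) X)
        (fderiv ℝ (fun w => fderiv ℝ F w X) w₀ 1) 0 := by
      intro X
      have := hasDerivAt_comp_add_real (F := fun w => fderiv ℝ F w X) (w := w₀) (t := 0)
        (by rw [hw₀0]; exact hdiff' X _ hw₀)
      rwa [hw₀0] at this
    rw [hw₀0] at d0
    rw [hA]
    simp only [hu]
    exact ((d0.fun_const_smul (inner ℂ (F w₀) v)).fun_add ((d1 1).fun_const_smul _)).fun_add
      ((d1 Complex.I).fun_const_smul _)
  have hnear : ∀ᶠ t : ℝ in 𝓝 0, |t| < r / 2 := by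
    have : Filter.Tendsto (fun t : ℝ => |t|) (𝓝 0) (𝓝 0) := by
      simpa using (continuous_abs (G := ℝ)).tendsto 0
    exact this.eventually_lt_const (by linarith)
  have hball : Metric.ball w₀ (r / 2) ∈ 𝓝 w₀ := Metric.ball_mem_nhds _ (by linarith)
  have hUd : ∀ t : ℝ, |t| < r / 2 → ∀ X, fderiv ℝ F (w₀ + t) X = U t (fderiv ℝ F w₀ X) := by
    intro t ht X
    exact fderiv_map_comp (hdiff w₀ hw₀)
      (Filter.mem_of_superset hball fun w hw => hUF t ht w hw) X
  have hUu : ∀ t : ℝ, |t| < r / 2 → ∀ v, u v t = U t v := by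
    intro t ht v
    conv_rhs => rw [hexp v]
    simp only [hu, map_add, map_smul, hUd t ht, hUF t ht w₀ (Metric.mem_ball_self (by linarith)), hρ]
  have hAsu : IsInfinitesimalSU A := by
    refine ⟨fun a b => ?_, fun a b => ?_⟩
    · have h1 := (hud a).inner ℂ (hud b)
      rw [hu0, hu0] at h1
      have h2 : (fun t => inner ℂ (u a t) (u b t)) =ᶠ[𝓝 0] fun _ => inner ℂ a b := by
        filter_upwards [hnear] with t ht
        rw [hUu t ht, hUu t ht, (hU t ht).inner_map]
      rw [add_comm]
      exact h1.unique ((hasDerivAt_const (0 : ℝ) (inner ℂ a b)).congr_of_eventuallyEq h2)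
    · have h1 := (hud a).jc (hud b)
      rw [hu0, hu0] at h1
      have h2 : u (jc a b) =ᶠ[𝓝 0] fun t => jc (u a t) (u b t) := by
        filter_upwards [hnear] with t ht
        rw [hUu t ht, hUu t ht, hUu t ht, (hU t ht).map_jc]
      exact (hud (jc a b)).unique (h1.congr_of_eventuallyEq h2)
  have hsub : Metric.ball w₀ (r / 2) ⊆ Metric.ball w₀ r := Metric.ball_subset_ball (by linarith)
  have hAF : ∀ w ∈ Metric.ball w₀ (r / 2), fderiv ℝ F w 1 = A (F w) := by
    intro w hw
    have hw0 : w + ((0 : ℝ) : ℂ) = w := by simp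
    have d0 := hasDerivAt_comp_add_real (F := F) (w := w) (t := 0)
      (by rw [hw0]; exact hdiff _ (hsub hw))
    rw [hw0] at d0
    refine d0.unique ((hud (F w)).congr_of_eventuallyEq ?_)
    filter_upwards [hnear] with t ht
    rw [hUu t ht, hUF t ht w hw]
  have hflow : ∀ t : ℝ, |t| < r / 4 → ∀ w ∈ Metric.ball w₀ (r / 4), F (w + t) = flow A t (F w) := by
    intro t ht w hw
    have := hAsu.eqOn_flow (w := fun t : ℝ => F (w + t)) (s := Set.Ioo (-(r / 4)) (r / 4))
      isOpen_Ioo isPreconnected_Ioo ⟨by linarith, by linarith⟩ (fun s hs => by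
        have hmem : w + s ∈ Metric.ball w₀ (r / 2) :=
          add_mem_ball hw (by linarith [abs_lt.2 hs])
        rw [← hAF _ hmem]
        exact hasDerivAt_comp_add_real (hdiff _ (hsub hmem))) t (abs_lt.1 ht)
    simpa using this
  have hsmall : ∀ t : ℝ, |t| < r / 4 → ∀ v p, IsRep v p → IsRep (flow A t v) (R t p) := by
    intro t ht v p hvp
    have ht2 : |t| < r / 2 := by linarith
    have hb4 : Metric.ball w₀ (r / 4) ∈ 𝓝 w₀ := Metric.ball_mem_nhds _ (by linarith)
    have hd : ∀ X, fderiv ℝ F (w₀ + t) X = flow A t (fderiv ℝ F w₀ X) := fun X =>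
      fderiv_map_comp (hdiff w₀ hw₀)
        (Filter.mem_of_superset hb4 fun w hw => hflow t ht w hw) X
    have : flow A t v = u v t := by
      conv_lhs => rw [hexp v]
      simp only [hu, map_add, map_smul, hd, hflow t ht w₀ (Metric.mem_ball_self (by linarith)), hρ]
    rw [this, hUu t ht2]
    exact hUR t ht2 v p hvp
  refine ⟨A, hAsu, fun t v p hvp => ?_⟩
  -- Both sides are one-parameter groups, so agreement for small times propagates to all times via
  -- `t = n (t / n)`.
  have hmul : ∀ s : ℝ, |s| < r / 4 → ∀ n : ℕ, IsRep (flow A (n * s) v) (R (n * s) p) := by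
    intro s hs n
    induction n with
    | zero => simpa [hR.map_zero] using hvp
    | succ n ih =>
      have := hsmall s hs _ _ ih
      have e : ((n + 1 : ℕ) : ℝ) * s = s + n * s := by push_cast; ring
      rw [e, flow_add_apply, hR.add]
      exact this
  obtain ⟨n, hn⟩ := exists_nat_gt (|t| / (r / 4))
  have hn0 : (0 : ℝ) < n := lt_of_le_of_lt (by positivity) hn
  have h1 := hmul (t / n) (by
    rw [abs_div, Nat.abs_cast, div_lt_iff₀ hn0]
    rw [div_lt_iff₀ (by linarith)] at hn
    linarith) n
  rwa [mul_div_cancel₀ _ hn0.ne'] at h1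

/-- Every special lift of an equivariant map satisfies the infinitesimal equivariance equation. -/
theorem IsSpecialOn.fderiv_one_eq {F : ℂ → C3} {f₀ : ℂ → CP2} {V : Set ℂ}
    {R : ℝ → Equiv.Perm CP2} (hF : IsSpecialOn F V) (hl : IsLiftOn F f₀ V)
    (hf : ∀ t : ℝ, ∀ w ∈ V, f₀ (w + t) = R t (f₀ w)) {A : C3 →L[ℂ] C3} (hA : IsInfinitesimalSU A)
    (hAR : ∀ t v p, IsRep v p → IsRep (flow A t v) (R t p)) {w : ℂ} (hw : w ∈ V) :
    fderiv ℝ F w 1 = A (F w) := by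
  obtain ⟨r, hr, hrV⟩ := Metric.isOpen_iff.1 hF.isOpen w hw
  have hFr := hF.mono Metric.isOpen_ball hrV
  have key : ∀ t : ℝ, |t| < r / 2 → ∃ c : ℂ, c ^ 3 = 1 ∧ F (w + t) = c • flow A t (F w) := by
    intro t ht
    obtain ⟨c, hc, h⟩ := hFr.exists_shift (fun z hz => hl z (hrV hz)) (hA.isSU_flow t) (hAR t)
      (fun z hz => hf t z (hrV hz)) ht
    exact ⟨c, hc, h w (Metric.mem_ball_self (by linarith))⟩
  have hw0 : w + ((0 : ℝ) : ℂ) = w := by simp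
  have d0 := hasDerivAt_comp_add_real (F := F) (w := w) (t := 0)
    (by rw [hw0]; exact hF.smooth.differentiableAt_of_mem hF.isOpen hw)
  rw [hw0] at d0
  have d1 := hasDerivAt_flow_apply A (F w) 0
  rw [flow_zero_apply] at d1
  refine d0.unique (d1.congr_of_eventuallyEq ?_)
  -- The cube root `c` relating `F (w + t)` to the flow equals this inner product, which tends to
  -- `1`; by discreteness `c = 1` for small `t`.
  have hcont : Filter.Tendsto (fun t : ℝ => ‖inner ℂ (flow A t (F w)) (F (w + t)) - 1‖) (𝓝 0)
      (𝓝 0) := by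
    have h := ((d1.continuousAt.inner d0.continuousAt (𝕜 := ℂ)).sub
      (continuousAt_const (y := (1 : ℂ)))).norm
    have e : ‖inner ℂ (flow A 0 (F w)) (F (w + ((0 : ℝ) : ℂ))) - 1‖ = 0 := by
      rw [hw0, flow_zero_apply, inner_self_eq_norm_sq_to_K, (hF.special w hw).norm_eq]
      simp
    simp only [ContinuousAt, Pi.sub_apply, e] at h
    exact h
  have hnear : ∀ᶠ t : ℝ in 𝓝 0, |t| < r / 2 := by
    have : Filter.Tendsto (fun t : ℝ => |t|) (𝓝 0) (𝓝 0) := by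
      simpa using (continuous_abs (G := ℝ)).tendsto 0
    exact this.eventually_lt_const (by linarith)
  filter_upwards [hnear, hcont.eventually_lt_const (by norm_num : (0 : ℝ) < 1 / 2)] with t ht ht'
  obtain ⟨c, hc, h⟩ := key t ht
  rw [h, inner_smul_right, (hA.isSU_flow t).inner_map, inner_self_eq_norm_sq_to_K,
    (hF.special w hw).norm_eq] at ht'
  rw [h, eq_one_of_cube hc (by simpa using ht'), one_smul]

/-! ### The ordinary differential equation of equivariant special lifts -/

open scoped NNReal in
/-- A bounded Lipschitz vector field is complete. -/
theorem exists_global_solution {E : Type*} [NormedAddCommGroup E] [NormedSpace ℝ E]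
    [CompleteSpace E] {v : E → E} {K L : ℝ≥0} (hK : LipschitzWith K v) (hL : ∀ x, ‖v x‖ ≤ L)
    (x₀ : E) : ∃ γ : ℝ → E, γ 0 = x₀ ∧ ∀ t, HasDerivAt γ (v (γ t)) t := by
  have hloc : ∀ T : ℝ, 0 < T → ∃ α : ℝ → E, α 0 = x₀ ∧
      ∀ t ∈ Set.Icc (-T) T, HasDerivWithinAt α (v (α t)) (Set.Icc (-T) T) t := by
    intro T hT
    -- A solution of speed at most `L` stays in the ball of radius `L T`, so there is no restriction
    -- on `T`.
    have h : IsPicardLindelof (fun _ => v) (tmin := -T) (tmax := T)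
        ⟨0, by constructor <;> linarith⟩ x₀ (L * T.toNNReal) 0 L K := by
      refine IsPicardLindelof.of_time_independent (fun x _ => hL x) hK.lipschitzOnWith ?_
      simp [Real.coe_toNNReal T hT.le]
    exact h.exists_eq_forall_mem_Icc_hasDerivWithinAt₀
  choose! α hα0 hα using hloc
  have hαd : ∀ T : ℝ, 0 < T → ∀ t ∈ Set.Ioo (-T) T, HasDerivAt (α T) (v (α T t)) t :=
    fun T hT t ht => (hα T hT t (Set.Ioo_subset_Icc_self ht)).hasDerivAt
      (Icc_mem_nhds ht.1 ht.2)
  have hagree : ∀ T T' : ℝ, 0 < T → T ≤ T' → ∀ t ∈ Set.Icc (-T) T, α T t = α T' t := by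
    intro T T' hT hTT'
    have hT' : 0 < T' := hT.trans_le hTT'
    have hsub : Set.Icc (-T) T ⊆ Set.Icc (-T') T' := Set.Icc_subset_Icc (by linarith) hTT'
    exact ODE_solution_unique_of_mem_Icc (v := fun _ => v) (s := fun _ => Set.univ) (t₀ := 0)
      (fun _ _ => hK.lipschitzOnWith) ⟨by linarith, hT⟩
      (fun t ht => (hα T hT t ht).continuousWithinAt) (hαd T hT) (fun _ _ => Set.mem_univ _)
      (fun t ht => ((hα T' hT' t (hsub ht)).mono hsub).continuousWithinAt)
      (fun t ht => hαd T' hT' t ⟨by linarith [ht.1], by linarith [ht.2]⟩)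
      (fun _ _ => Set.mem_univ _) (by rw [hα0 T hT, hα0 T' hT'])
  have key : ∀ T : ℝ, 0 < T → ∀ t ∈ Set.Ioo (-T) T, α (|t| + 1) t = α T t := by
    intro T hT t ht
    have h1 : |t| < T := abs_lt.2 ht
    rcases le_total (|t| + 1) T with h | h
    · exact hagree _ _ (by positivity) h t (abs_le.1 (by linarith))
    · exact (hagree _ _ hT h t (abs_le.1 h1.le)).symm
  -- Gluing: the solution on `[-(|t| + 1), |t| + 1]` has `t` in the interior of its domain.
  refine ⟨fun t => α (|t| + 1) t, by simpa using hα0 1 one_pos, fun t => ?_⟩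
  have hT : 0 < |t| + 1 := by positivity
  have ht : t ∈ Set.Ioo (-(|t| + 1)) (|t| + 1) := abs_lt.1 (by linarith)
  refine (hαd _ hT t ht).congr_of_eventuallyEq ?_
  filter_upwards [Ioo_mem_nhds ht.1 ht.2] with s hs using key _ hT s hs

/-- A smooth cutoff function which is `1` on the ball of radius `2`. -/
def cutoff : ContDiffBump (0 : C3) := ⟨2, 3, by norm_num, by norm_num⟩

theorem cutoff_eq_one {x : C3} (hx : ‖x‖ = 1) : cutoff x = 1 := by
  apply cutoff.one_of_mem_closedBall
  rw [mem_closedBall_zero_iff, hx]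
  norm_num [cutoff]

/-- The derivative of an equivariant special lift in the direction `X`, multiplied by a cutoff
function. -/
def cutField (A : C3 →L[ℂ] C3) (X : ℂ) (x : C3) : C3 :=
  cutoff x • (X.re • A x + X.im • jc x (A x))

theorem contDiff_cutField (A : C3 →L[ℂ] C3) (X : ℂ) : ContDiff ℝ 1 (cutField A X) := by
  have hA : ContDiff ℝ 1 (fun x => A x) := (A.restrictScalars ℝ).contDiff
  have hj : ContDiff ℝ 1 (fun x => jc x (A x)) :=
    jcL.isBoundedBilinearMap.contDiff.comp (contDiff_id.prodMk hA)
  have h1 : ContDiff ℝ 1 fun x => X.re • A x + X.im • jc x (A x) :=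
    (hA.const_smul X.re).add (hj.const_smul X.im)
  have h2 : ContDiff ℝ 1 (cutoff : C3 → ℝ) := cutoff.contDiff
  exact h2.smul h1

theorem hasCompactSupport_cutField (A : C3 →L[ℂ] C3) (X : ℂ) :
    HasCompactSupport (cutField A X) :=
  cutoff.hasCompactSupport.smul_right

open scoped NNReal in
theorem exists_lipschitzWith_cutField (A : C3 →L[ℂ] C3) (X : ℂ) :
    ∃ K : ℝ≥0, LipschitzWith K (cutField A X) :=
  (contDiff_cutField A X).lipschitzWith_of_hasCompactSupport (hasCompactSupport_cutField A X)
    one_ne_zero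

theorem cutField_of_norm_eq_one (A : C3 →L[ℂ] C3) (X : ℂ) {x : C3} (hx : ‖x‖ = 1) :
    cutField A X x = X.re • A x + X.im • jc x (A x) := by
  rw [cutField, cutoff_eq_one hx, one_smul]

/-- Equivariant special lifts are determined by their value at one point. -/
theorem IsSpecialOn.eqOn_of_eq {F G : ℂ → C3} {V : Set ℂ} (hF : IsSpecialOn F V)
    (hG : IsSpecialOn G V) (hV : Convex ℝ V) {A : C3 →L[ℂ] C3}
    (hFA : ∀ z ∈ V, fderiv ℝ F z 1 = A (F z)) (hGA : ∀ z ∈ V, fderiv ℝ G z 1 = A (G z))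
    {w : ℂ} (hw : w ∈ V) (hFG : F w = G w) {z : ℂ} (hz : z ∈ V) : F z = G z := by
  -- Along the segment from `w` to `z` both lifts solve one autonomous equation. The cutoff makes
  -- its field globally Lipschitz and changes nothing on the unit sphere.
  obtain ⟨K, hK⟩ := exists_lipschitzWith_cutField A (z - w)
  have hmem : ∀ t ∈ Set.Icc (0 : ℝ) 1, w + t • (z - w) ∈ V := fun t ht =>
    hV.add_smul_sub_mem hw hz ht
  have hder : ∀ H : ℂ → C3, IsSpecialOn H V → (∀ z ∈ V, fderiv ℝ H z 1 = A (H z)) →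
      ∀ t ∈ Set.Icc (0 : ℝ) 1, HasDerivAt (fun t : ℝ => H (w + t • (z - w)))
        (cutField A (z - w) (H (w + t • (z - w)))) t := by
    intro H hH hHA t ht
    have hs := hH.special _ (hmem t ht)
    have hd : HasDerivAt (fun t : ℝ => w + t • (z - w)) (z - w) t := by
      simpa using ((hasDerivAt_id t).smul_const (z - w)).const_add w
    have h1 := (hH.smooth.differentiableAt_of_mem hH.isOpen
      (hmem t ht)).hasFDerivAt.comp_hasDerivAt t hd
    rw [fderiv_eq_re_im, hs.fderiv_I, hHA _ (hmem t ht)] at h1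
    rw [cutField_of_norm_eq_one _ _ hs.norm_eq]
    exact h1
  have := ODE_solution_unique (v := fun _ => cutField A (z - w)) (a := 0) (b := 1) (fun _ => hK)
    (f := fun t : ℝ => F (w + t • (z - w))) (g := fun t : ℝ => G (w + t • (z - w)))
    (fun t ht => (hder F hF hFA t ht).continuousAt.continuousWithinAt)
    (fun t ht => (hder F hF hFA t (Set.Ico_subset_Icc_self ht)).hasDerivWithinAt)
    (fun t ht => (hder G hG hGA t ht).continuousAt.continuousWithinAt)
    (fun t ht => (hder G hG hGA t (Set.Ico_subset_Icc_self ht)).hasDerivWithinAt)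
    (by simpa using hFG) (Set.right_mem_Icc.2 zero_le_one)
  simpa using this

/-- The field `x × A x` is orthogonal to both `x` and `A x`. The first keeps solutions on the
compact sphere, hence complete; with skewness of `A`, the second preserves `⟨x, A x⟩ = 0`. -/
theorem exists_meridian {A : C3 →L[ℂ] C3} (hA : IsInfinitesimalSU A) {v : C3} (hv : ‖v‖ = 1)
    (hvA : inner ℂ v (A v) = 0) (hAv : A v ≠ 0) :
    ∃ γ : ℝ → C3, γ 0 = v ∧ (∀ t, HasDerivAt γ (jc (γ t) (A (γ t))) t) ∧ (∀ t, ‖γ t‖ = 1) ∧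
      (∀ t, inner ℂ (γ t) (A (γ t)) = 0) ∧ ∀ t, A (γ t) ≠ 0 := by
  obtain ⟨K, hK⟩ := exists_lipschitzWith_cutField A Complex.I
  obtain ⟨L, hL⟩ := (contDiff_cutField A Complex.I).continuous.bounded_above_of_compact_support
    (hasCompactSupport_cutField A Complex.I)
  obtain ⟨γ, hγ0, hγ⟩ := exists_global_solution hK (L := L.toNNReal)
    (fun x => (hL x).trans (Real.le_coe_toNNReal L)) v
  have hcut : ∀ x, cutField A Complex.I x = cutoff x • jc x (A x) := fun x => by simp [cutField]
  have horth : ∀ x, inner ℂ x (cutField A Complex.I x) = 0 := fun x => by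
    rw [hcut, RCLike.real_smul_eq_coe_smul (K := ℂ), inner_smul_right, inner_jc_left, mul_zero]
  have horth' : ∀ x, inner ℂ (A x) (cutField A Complex.I x) = 0 := fun x => by
    rw [hcut, RCLike.real_smul_eq_coe_smul (K := ℂ), inner_smul_right, inner_jc_right, mul_zero]
  have hn : ∀ t, ‖γ t‖ = 1 := by
    intro t
    have hd : ∀ t, HasDerivAt (fun t => inner ℂ (γ t) (γ t)) 0 t := by
      intro t
      have := (hγ t).inner ℂ (hγ t)
      rwa [horth, ← inner_conj_symm, horth, map_zero, add_zero] at this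
    have := is_const_of_deriv_eq_zero (fun t => (hd t).differentiableAt) (fun t => (hd t).deriv) t 0
    rw [hγ0, inner_self_eq_norm_sq_to_K, inner_self_eq_norm_sq_to_K, hv] at this
    have h2 : ‖γ t‖ ^ 2 = 1 := by
      apply Complex.ofReal_injective
      push_cast
      simpa using this
    exact (pow_eq_one_iff_of_nonneg (norm_nonneg _) (by norm_num)).1 h2
  have hγ' : ∀ t, HasDerivAt γ (jc (γ t) (A (γ t))) t := by
    intro t
    have := hγ t
    rwa [hcut, cutoff_eq_one (hn t), one_smul] at this
  have hdA : ∀ t, HasDerivAt (fun t => A (γ t)) (A (cutField A Complex.I (γ t))) t := fun t =>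
    ((A.restrictScalars ℝ).hasFDerivAt (x := γ t)).comp_hasDerivAt t (hγ t)
  refine ⟨γ, hγ0, hγ', hn, fun t => ?_, fun t ht => hAv ?_⟩
  · have hd : ∀ t, HasDerivAt (fun t => inner ℂ (γ t) (A (γ t))) 0 t := by
      intro t
      have := (hγ t).inner ℂ (hdA t)
      rwa [eq_neg_of_add_eq_zero_right (hA.skew _ _), horth', ← inner_conj_symm _ (A (γ t)), horth',
        map_zero, neg_zero, add_zero] at this
    have := is_const_of_deriv_eq_zero (fun t => (hd t).differentiableAt) (fun t => (hd t).deriv) t 0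
    rw [this, hγ0, hvA]
  -- A zero of `A` is an equilibrium of the field, so by uniqueness a solution meeting one is
  -- constant, contradicting `A v ≠ 0`.
  · have hconst : γ = fun _ => γ t := by
      refine ODE_solution_unique_univ (v := fun _ => cutField A Complex.I) (s := fun _ => Set.univ)
        (t₀ := t) (K := K) (fun _ => hK.lipschitzOnWith) (fun s => ⟨hγ s, Set.mem_univ _⟩)
        (fun s => ⟨?_, Set.mem_univ _⟩) rfl
      have : cutField A Complex.I (γ t) = 0 := by
        rw [hcut, ht]
        have : jc (γ t) 0 = 0 := by simpa using jc_real_smul_right 0 (γ t) 0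
        rw [this, smul_zero]
      rw [this]
      exact hasDerivAt_const s (γ t)
    rw [← hγ0, hconst]
    exact ht

/-- The equivariant special lift through a given point. -/
theorem exists_equivariant_special {A : C3 →L[ℂ] C3} (hA : IsInfinitesimalSU A) {v : C3}
    (hv : ‖v‖ = 1) (hvA : inner ℂ v (A v) = 0) (hAv : A v ≠ 0) (w₀ : ℂ) :
    ∃ Γ : ℂ → C3, IsSpecialOn Γ Set.univ ∧ Γ w₀ = v ∧ (∀ w, fderiv ℝ Γ w 1 = A (Γ w)) ∧
      ∀ (w : ℂ) (t : ℝ), Γ (w + t) = flow A t (Γ w) := by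
  obtain ⟨γ, hγ0, hγ, hn, hγA, hAγ⟩ := exists_meridian hA hv hvA hAv
  have hγs : ContDiff ℝ ∞ γ := by
    have hd : deriv γ = fun t => jc (γ t) (A (γ t)) := funext fun t => (hγ t).deriv
    rw [contDiff_infty]
    intro n
    induction n with
    | zero =>
      exact contDiff_zero.2 (continuous_iff_continuousAt.2 fun t => (hγ t).continuousAt)
    | succ n ih =>
      have e : ((n + 1 : ℕ) : WithTop ℕ∞) = (n : WithTop ℕ∞) + 1 := by push_cast; rfl
      refine e ▸ contDiff_succ_iff_deriv.2 ⟨fun t => (hγ t).differentiableAt, by simp, ?_⟩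
      rw [hd]
      exact jcL.isBoundedBilinearMap.contDiff.comp
        (ih.prodMk ((A.restrictScalars ℝ).contDiff.comp ih))
  -- Real translations act by the flow, and `γ` is the profile along the imaginary direction. As the
  -- flow commutes with `A` and with `jc`, the equation for `γ` holds along every translate.
  set Γ : ℂ → C3 := fun w => flow A (w - w₀).re (γ (w - w₀).im) with hΓ
  have hadd : ∀ (w : ℂ) (t : ℝ), Γ (w + t) = flow A t (Γ w) := by
    intro w t
    simp only [hΓ, ← flow_add_apply]
    congr 2
    · simp; ring
    · simp
  have hΓs : ContDiff ℝ ∞ Γ := by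
    have h1 : ContDiff ℝ ∞ (fun w : ℂ => (ContinuousLinearMap.restrictScalarsL ℂ C3 C3 ℝ ℝ)
        (flow A (w - w₀).re)) :=
      (ContinuousLinearMap.contDiff _).comp ((contDiff_flow A).comp
        (Complex.reCLM.contDiff.comp (contDiff_id.sub contDiff_const)))
    exact h1.clm_apply (hγs.comp (Complex.imCLM.contDiff.comp (contDiff_id.sub contDiff_const)))
  have hΓd : ∀ w, DifferentiableAt ℝ Γ w := fun w => hΓs.contDiffAt.differentiableAt (by simp)
  have hone : ∀ w, fderiv ℝ Γ w 1 = A (Γ w) := by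
    intro w
    have hw0 : w + ((0 : ℝ) : ℂ) = w := by simp
    have d0 := hasDerivAt_comp_add_real (F := Γ) (w := w) (t := 0) (hΓd _)
    simp only [hw0, hadd] at d0
    have d1 := hasDerivAt_flow_apply A (Γ w) 0
    rw [flow_zero_apply] at d1
    exact d0.unique d1
  have hI : ∀ w, fderiv ℝ Γ w Complex.I = jc (Γ w) (A (Γ w)) := by
    intro w
    have h1 : HasDerivAt (fun t : ℝ => w + t * Complex.I) Complex.I 0 := by
      simpa using ((Complex.ofRealCLM.hasDerivAt (x := 0)).mul_const Complex.I).const_add w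
    have h0 : w + ((0 : ℝ) : ℂ) * Complex.I = w := by simp
    have d0 := (show HasFDerivAt Γ (fderiv ℝ Γ (w + ((0 : ℝ) : ℂ) * Complex.I))
      (w + ((0 : ℝ) : ℂ) * Complex.I) from (hΓd _).hasFDerivAt).comp_hasDerivAt (0 : ℝ) h1
    rw [h0] at d0
    have e : Γ ∘ (fun t : ℝ => w + t * Complex.I) =
        fun t => flow A (w - w₀).re (γ ((w - w₀).im + t)) := by
      funext t
      simp only [hΓ, Function.comp]
      congr 2 <;> simp
      ring
    have hγt : HasDerivAt (fun t => γ ((w - w₀).im + t))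
        (jc (γ (w - w₀).im) (A (γ (w - w₀).im))) 0 := by
      have := (hγ ((w - w₀).im + 0)).comp_const_add (w - w₀).im 0
      simpa using this
    have d1 := (((flow A (w - w₀).re).restrictScalars ℝ).hasFDerivAt).comp_hasDerivAt 0 hγt
    rw [e] at d0
    have := d0.unique d1
    rw [this]
    change flow A (w - w₀).re (jc (γ (w - w₀).im) (A (γ (w - w₀).im))) = _
    rw [(hA.isSU_flow _).map_jc, flow_comm]
  refine ⟨Γ, ⟨isOpen_univ, hΓs.contDiffOn, fun w _ => ?_⟩, by simp [hΓ, hγ0], hone, hadd⟩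
  have hAΓ : A (Γ w) = flow A (w - w₀).re (A (γ (w - w₀).im)) := (flow_comm _ _ _).symm
  refine IsSpecialAt.of_fderiv_one ?_ ?_ (by rw [hone, hI]) ?_
  · simp only [hΓ]
    rw [(hA.isSU_flow _).norm_map, hn]
  · rw [hone, hAΓ, (hA.isSU_flow _).inner_map, hγA]
  · rw [hone, hAΓ]
    exact (hA.isSU_flow _).map_ne_zero (hAγ _)

/-! ### Extension of equivariant minimal Lagrangian immersions -/

/-- A translationally equivariant minimal Lagrangian immersion of a convex set, given by local
special lifts, is covered by an equivariant special lift of the plane. -/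
theorem exists_global_special_lift {S : Set ℂ} (hSc : Convex ℝ S)
    (hSn : S.Nonempty) {f₀ : ℂ → CP2}
    (hloc : ∀ w ∈ S, ∃ (V : Set ℂ) (F : ℂ → C3), w ∈ V ∧ V ⊆ S ∧ IsSpecialOn F V ∧ IsLiftOn F f₀ V)
    {R : ℝ → Equiv.Perm CP2} (hR : IsOneParameterIsometryGroup R)
    (hf : ∀ t : ℝ, ∀ w ∈ S, f₀ (w + t) = R t (f₀ w)) :
    ∃ (A : C3 →L[ℂ] C3) (Γ : ℂ → C3), IsInfinitesimalSU A ∧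
      (∀ t v p, IsRep v p → IsRep (flow A t v) (R t p)) ∧ IsSpecialOn Γ Set.univ ∧
      (∀ w, fderiv ℝ Γ w 1 = A (Γ w)) ∧ (∀ (w : ℂ) (t : ℝ), Γ (w + t) = flow A t (Γ w)) ∧
      IsLiftOn Γ f₀ S := by
  have hball : ∀ w ∈ S, ∃ (r : ℝ) (F : ℂ → C3), 0 < r ∧ Metric.ball w r ⊆ S ∧
      IsSpecialOn F (Metric.ball w r) ∧ IsLiftOn F f₀ (Metric.ball w r) := by
    intro w hw
    obtain ⟨V, F, hwV, hVS, hF, hl⟩ := hloc w hw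
    obtain ⟨r, hr, hrV⟩ := Metric.isOpen_iff.1 hF.isOpen w hwV
    exact ⟨r, F, hr, hrV.trans hVS, hF.mono Metric.isOpen_ball hrV, fun z hz => hl z (hrV hz)⟩
  obtain ⟨w₀, hw₀⟩ := hSn
  obtain ⟨r, F, hr, hrS, hF, hl⟩ := hball w₀ hw₀
  obtain ⟨A, hA, hAR⟩ := hF.exists_generator hr hl hR (fun t w hw => hf t w (hrS hw))
  have hw₀r : w₀ ∈ Metric.ball w₀ r := Metric.mem_ball_self hr
  have hFA : ∀ z ∈ Metric.ball w₀ r, fderiv ℝ F z 1 = A (F z) := fun z hz =>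
    hF.fderiv_one_eq hl (fun t w hw => hf t w (hrS hw)) hA hAR hz
  have hs := hF.special w₀ hw₀r
  obtain ⟨Γ, hΓ, hΓ0, hΓA, hΓadd⟩ := exists_equivariant_special hA hs.norm_eq
    (by rw [← hFA _ hw₀r]; exact hs.horizontal 1) (by rw [← hFA _ hw₀r]; exact hs.ne_zero) w₀
  refine ⟨A, Γ, hA, hAR, hΓ, hΓA, hΓadd, ?_⟩
  -- Unique continuation: `E` is open by construction, and relative closedness in the connected set
  -- `S` is proved by comparison with a local special lift.
  set E : Set ℂ := {w | ∀ᶠ z in 𝓝 w, IsRep (Γ z) (f₀ z)} with hE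
  have hEo : IsOpen E := by
    rw [isOpen_iff_mem_nhds]
    intro w hw
    exact eventually_eventually_nhds.2 hw
  have hEw₀ : w₀ ∈ E := by
    refine Filter.mem_of_superset (Metric.ball_mem_nhds w₀ hr) fun z hz => ?_
    have := hF.eqOn_of_eq (hΓ.mono Metric.isOpen_ball (Set.subset_univ _)) (convex_ball _ _) hFA
      (fun z _ => hΓA z) hw₀r hΓ0.symm hz
    change IsRep (Γ z) (f₀ z)
    rw [← this]
    exact hl z hz
  have hES : S ⊆ E := by
    refine hSc.isPreconnected.subset_of_closure_inter_subset hEo ⟨w₀, hw₀, hEw₀⟩ ?_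
    rintro w₁ ⟨hw₁c, hw₁⟩
    obtain ⟨s, G, hs, hsS, hG, hGl⟩ := hball w₁ hw₁
    have hGA : ∀ z ∈ Metric.ball w₁ s, fderiv ℝ G z 1 = A (G z) := fun z hz =>
      hG.fderiv_one_eq hGl (fun t w hw => hf t w (hsS hw)) hA hAR hz
    obtain ⟨w₂, hw₂, hw₂E⟩ := mem_closure_iff.1 hw₁c _ Metric.isOpen_ball (Metric.mem_ball_self hs)
    obtain ⟨δ, hδ, hδs⟩ := Metric.mem_nhds_iff.1
      (Filter.inter_mem (Metric.isOpen_ball.mem_nhds hw₂) hw₂E)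
    have hsub : Metric.ball w₂ δ ⊆ Metric.ball w₁ s := fun z hz => (hδs hz).1
    -- Near `w₂` both `G` and `Γ` lift `f₀`, so they differ by a cube root of unity. Then `c • Γ`
    -- solves the same equations as `G` and agrees with it on the whole ball around `w₁`.
    obtain ⟨c, hc, hcG⟩ := (hG.mono Metric.isOpen_ball hsub).eq_smul
      (hΓ.mono Metric.isOpen_ball (Set.subset_univ _)) (convex_ball _ _).isPreconnected
      (fun z hz => (hGl z (hsub hz)).exists_eq_smul (hδs hz).2)
    have hc1 := norm_eq_one_of_cube hc
    have hc0 : c ≠ 0 := by rw [← norm_ne_zero_iff, hc1]; simp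
    have hone : IsSU (1 : C3 →L[ℂ] C3) := ⟨fun _ _ => rfl, fun _ _ => rfl⟩
    have hcΓ : IsSpecialOn (fun z => c • Γ z) (Metric.ball w₁ s) :=
      (hΓ.mono Metric.isOpen_ball (Set.subset_univ _)).map (hone.smul hc1 hc)
    have hcA : ∀ z ∈ Metric.ball w₁ s, fderiv ℝ (fun z => c • Γ z) z 1 = A (c • Γ z) := by
      intro z _
      rw [fderiv_fun_const_smul (hΓ.smooth.differentiableAt_of_mem isOpen_univ (Set.mem_univ z)),
        map_smul, ← hΓA]
      rfl
    refine Filter.mem_of_superset (Metric.ball_mem_nhds w₁ hs) fun z hz => ?_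
    have := hG.eqOn_of_eq hcΓ (convex_ball _ _) hGA hcA hw₂ (hcG w₂ (Metric.mem_ball_self hδ)) hz
    have h2 := (hGl z hz).smul (inv_ne_zero hc0)
    rwa [this, smul_smul, inv_mul_cancel₀ hc0, one_smul] at h2
  exact fun z hz => (hES hz).self_of_nhds

theorem IsSpecialOn.ne_zero {F : ℂ → C3} {V : Set ℂ} (hF : IsSpecialOn F V) {z : ℂ} (hz : z ∈ V) :
    F z ≠ 0 := by
  rw [← norm_ne_zero_iff, (hF.special z hz).norm_eq]; simp

/-- If the map covered by an equivariant special lift is periodic on a convex open set, then the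
lift is periodic on the whole plane up to a constant factor. -/
theorem exists_smul_of_periodic {S : Set ℂ} (hSo : IsOpen S)
    (hSn : S.Nonempty) {f₀ : ℂ → CP2} {A : C3 →L[ℂ] C3} {Γ : ℂ → C3}
    (hΓ : IsSpecialOn Γ Set.univ) (hΓA : ∀ w, fderiv ℝ Γ w 1 = A (Γ w))
    (hl : IsLiftOn Γ f₀ S) {τ : ℝ}
    (hτS : ∀ w ∈ S, w + τ ∈ S) (hτ : ∀ w ∈ S, f₀ (w + τ) = f₀ w) :
    ∃ c : ℂ, c ≠ 0 ∧ ∀ w, Γ (w + τ) = c • Γ w := by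
  obtain ⟨w₀, hw₀⟩ := hSn
  obtain ⟨r, hr, hrS⟩ := Metric.isOpen_iff.1 hSo w₀ hw₀
  have hsh : IsSpecialOn (fun w => Γ (w + τ)) Set.univ :=
    hΓ.comp_add τ isOpen_univ fun _ _ => Set.mem_univ _
  -- On a small ball the shifted lift covers the same map as `Γ`, which fixes the factor; uniqueness
  -- for the differential equation then extends the relation to the plane.
  obtain ⟨c, hc, hcG⟩ := (hsh.mono Metric.isOpen_ball (Set.subset_univ _)).eq_smul
    (hΓ.mono Metric.isOpen_ball (Set.subset_univ _)) (convex_ball w₀ r).isPreconnected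
    (fun z hz => by
      have h1 := hl _ (hτS z (hrS hz))
      rw [hτ z (hrS hz)] at h1
      exact h1.exists_eq_smul (hl z (hrS hz)))
  have hc1 := norm_eq_one_of_cube hc
  have hc0 : c ≠ 0 := by rw [← norm_ne_zero_iff, hc1]; simp
  have hone : IsSU (1 : C3 →L[ℂ] C3) := ⟨fun _ _ => rfl, fun _ _ => rfl⟩
  have hcΓ : IsSpecialOn (fun z => c • Γ z) Set.univ := hΓ.map (hone.smul hc1 hc)
  have hcA : ∀ z ∈ Set.univ, fderiv ℝ (fun z => c • Γ z) z 1 = A (c • Γ z) := by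
    intro z _
    rw [fderiv_fun_const_smul (hΓ.smooth.differentiableAt_of_mem isOpen_univ (Set.mem_univ z)),
      map_smul, ← hΓA]
    rfl
  have hshA : ∀ z ∈ Set.univ, fderiv ℝ (fun w => Γ (w + τ)) z 1 = A (Γ (z + τ)) := by
    intro z _
    have : fderiv ℝ (fun w => Γ (w + τ)) z = fderiv ℝ Γ (z + τ) := fderiv_comp_add_right _
    rw [this, hΓA]
  exact ⟨c, hc0, fun w => hsh.eqOn_of_eq hcΓ convex_univ hshA hcA (Set.mem_univ w₀)
    (hcG w₀ (Metric.mem_ball_self hr)) (Set.mem_univ w)⟩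

/-- The extension theorem for domains whose preimage under `w ↦ e^{iw}` is convex. -/
theorem exists_extension {M : Set ℂ} (hM0 : M ⊆ puncturedPlane) (hMn : M.Nonempty)
    (hMo : IsOpen M) (hMc : Convex ℝ ((fun w : ℂ => Complex.exp (Complex.I * w)) ⁻¹' M))
    (f : ℂ → CP2) (hf : IsMinimalLagrangianImmersion f M) (hrot : IsRotationallyEquivariant f M) :
    ∃ fExt fTilde : ℂ → CP2,
      (IsMinimalLagrangianImmersion fExt puncturedPlane ∧
        IsRotationallyEquivariant fExt puncturedPlane ∧
        Set.EqOn fExt f M) ∧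
      (IsMinimalLagrangianImmersion fTilde Set.univ ∧
        IsTranslationallyEquivariant fTilde Set.univ ∧
        ∀ w : ℂ, fTilde (w + 2 * Real.pi) = fTilde w) ∧
      ∀ w : ℂ, fExt (Complex.exp (Complex.I * w)) = fTilde w := by
  obtain ⟨R, hR, hRf⟩ := hrot
  set e : ℂ → ℂ := fun w => Complex.exp (Complex.I * w) with he
  have hecont : Continuous e := by fun_prop
  have hed : ∀ w, HasDerivAt e (Complex.I * e w) w := by
    intro w
    have := ((hasDerivAt_id w).const_mul Complex.I).cexp
    simpa [he, mul_comm] using this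
  have hesmooth : ContDiff ℝ ∞ e := by
    have : ContDiff ℝ ∞ Complex.exp := Complex.contDiff_exp
    exact this.comp (contDiff_const.mul contDiff_id)
  have he0 : ∀ w, e w ≠ 0 := fun w => Complex.exp_ne_zero _
  have headd : ∀ (w : ℂ) (t : ℝ), e (w + t) = Complex.exp (t * Complex.I) * e w := by
    intro w t
    simp only [he]
    rw [← Complex.exp_add]; ring_nf
  have heper : ∀ w, e (w + 2 * Real.pi) = e w := by
    intro w
    simp only [he]
    rw [mul_add, show Complex.I * (2 * (Real.pi : ℂ)) = 2 * Real.pi * Complex.I by ring,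
      Complex.exp_periodic]
  have hlog : ∀ z : ℂ, z ≠ 0 → e (-Complex.I * Complex.log z) = z := by
    intro z hz
    simp only [he]
    rw [← mul_assoc, mul_neg, Complex.I_mul_I, neg_neg, one_mul, Complex.exp_log hz]
  set S : Set ℂ := e ⁻¹' M with hS
  have hSo : IsOpen S := hMo.preimage hecont
  have hSn : S.Nonempty := by
    obtain ⟨z, hz⟩ := hMn
    exact ⟨-Complex.I * Complex.log z, by
      change e _ ∈ M
      rwa [hlog z (hM0 hz)]⟩
  have hequiv : ∀ t : ℝ, ∀ w ∈ S, f (e (w + t)) = R t (f (e w)) := by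
    intro t w hw
    rw [headd]
    exact (hRf t (e w) hw).2
  have hloc : ∀ w ∈ S, ∃ (V : Set ℂ) (F : ℂ → C3), w ∈ V ∧ V ⊆ S ∧ IsSpecialOn F V ∧
      IsLiftOn F (f ∘ e) V := by
    intro w hw
    obtain ⟨V, F, hwV, hVM, hF, hl⟩ := hf.exists_special hw
    have hVo : IsOpen (e ⁻¹' V) := hF.isOpen.preimage hecont
    exact ⟨e ⁻¹' V, F ∘ e, hwV, fun z hz => hVM hz,
      hF.comp hVo hesmooth.contDiffOn (fun z hz => hz) (fun z _ => hed z)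
        (fun z _ => mul_ne_zero Complex.I_ne_zero (he0 z)), fun z hz => hl (e z) hz⟩
  obtain ⟨A, Γ, -, hAR, hΓ, hΓA, hΓadd, hΓl⟩ :=
    exists_global_special_lift hMc hSn hloc hR hequiv
  obtain ⟨c, hc0, hcΓ⟩ := exists_smul_of_periodic (τ := 2 * Real.pi) hSo hSn hΓ hΓA hΓl
    (fun w hw => by
      change e _ ∈ M
      push_cast
      rwa [heper])
    (fun w _ => by
      simp only [Function.comp]
      push_cast
      rw [heper])
  set fT : ℂ → CP2 := fun w => Projectivization.mk ℂ (Γ w) (hΓ.ne_zero (Set.mem_univ w)) with hfT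
  have hTrep : ∀ w, IsRep (Γ w) (fT w) := fun w => IsRep.mk _
  -- The lift itself is periodic only up to the factor `c`, which disappears in projective space.
  have hTper : Function.Periodic fT (2 * Real.pi : ℂ) := by
    intro w
    have h1 := hTrep (w + ((2 * Real.pi : ℝ) : ℂ))
    rw [hcΓ] at h1
    have h2 := h1.unique ((hTrep w).smul hc0)
    push_cast at h2
    exact h2
  have hTe : ∀ w w', e w = e w' → fT w = fT w' := by
    intro w w' h
    obtain ⟨n, hn⟩ := Complex.exp_eq_exp_iff_exists_int.1 h
    have : w = w' + n * (2 * Real.pi : ℂ) := by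
      apply mul_left_cancel₀ Complex.I_ne_zero
      rw [hn]; ring
    rw [this]
    exact hTper.int_mul n w'
  have hTadd : ∀ (w : ℂ) (t : ℝ), fT (w + t) = R t (fT w) := by
    intro w t
    have h1 := hTrep (w + t)
    rw [hΓadd] at h1
    exact h1.unique (hAR t _ _ (hTrep w))
  have hTf : ∀ w ∈ S, fT w = f (e w) := fun w hw => (hTrep w).unique (hΓl w hw)
  -- The jump of the principal logarithm is harmless because, by `hTe`, `fT` depends only on `e w`.
  refine ⟨fun z => fT (-Complex.I * Complex.log z), fT, ⟨?_, ⟨R, hR, fun t z hz => ?_⟩, ?_⟩,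
    ⟨?_, ⟨R, hR, fun t w _ => ⟨Set.mem_univ _, hTadd w t⟩⟩, hTper⟩, fun w => ?_⟩
  · apply isMinimalLagrangianImmersion_of_special
    intro p hp
    have hp' : p ≠ 0 := hp
    set V : Set ℂ := (fun z => z / p) ⁻¹' Complex.slitPlane with hV
    have hVo : IsOpen V := Complex.isOpen_slitPlane.preimage (by fun_prop)
    -- A branch of the inverse of `e` that is holomorphic near `p`, also for `p` on the negative
    -- real axis.
    set φ : ℂ → ℂ := fun z => -Complex.I * (Complex.log (z / p) + Complex.log p) with hφ
    have hV0 : ∀ z ∈ V, z ≠ 0 := by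
      rintro z hz rfl
      exact Complex.slitPlane_ne_zero hz (zero_div _)
    have hφe : ∀ z ∈ V, e (φ z) = z := by
      intro z hz
      simp only [he, hφ]
      rw [← mul_assoc, mul_neg, Complex.I_mul_I, neg_neg, one_mul, Complex.exp_add,
        Complex.exp_log (Complex.slitPlane_ne_zero hz), Complex.exp_log hp', div_mul_cancel₀ _ hp']
    have hφd : ∀ z ∈ V, HasDerivAt φ (-Complex.I * ((1 / p) / (z / p))) z := by
      intro z hz
      exact ((((hasDerivAt_id z).div_const p).clog hz).add_const (Complex.log p)).const_mul
        (-Complex.I)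
    have hφs : ContDiffOn ℝ ∞ φ V := by
      intro z hz
      have h1 : ContDiffAt ℝ ∞ Complex.log (z / p) :=
        (Complex.contDiffAt_log hz).restrict_scalars ℝ
      have h2 : ContDiffAt ℝ ∞ (fun z => Complex.log (z / p)) z :=
        h1.comp z (contDiffAt_id.div_const p)
      exact (contDiffAt_const.mul (h2.add contDiffAt_const)).contDiffWithinAt
    refine ⟨V, Γ ∘ φ, by simp [hV, hp'], hV0, hΓ.comp hVo hφs (fun _ _ => Set.mem_univ _) hφd
      (fun z hz => ?_), fun z hz => ?_⟩
    · exact mul_ne_zero (neg_ne_zero.2 Complex.I_ne_zero) (div_ne_zero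
        (one_div_ne_zero hp') (div_ne_zero (hV0 z hz) hp'))
    · have : fT (-Complex.I * Complex.log z) = fT (φ z) :=
        hTe _ _ (by rw [hlog z (hV0 z hz), hφe z hz])
      simp only [this]
      exact hTrep _
  · have hz' : z ≠ 0 := hz
    have hne : Complex.exp (t * Complex.I) * z ≠ 0 := mul_ne_zero (Complex.exp_ne_zero _) hz'
    refine ⟨hne, ?_⟩
    simp only
    rw [← hTadd]
    apply hTe
    rw [hlog _ hne, headd, hlog z hz']
  · intro z hz
    simp only
    have hz' := hlog z (hM0 hz)
    rw [hTf _ (by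
      change e _ ∈ M
      rwa [hz']), hz']
  · exact isMinimalLagrangianImmersion_of_special fun p _ =>
      ⟨Set.univ, Γ, Set.mem_univ p, subset_rfl, hΓ, fun w _ => hTrep w⟩
  · exact hTe _ _ (hlog _ (he0 w))

/-! ### The three kinds of domains on the logarithmic cover -/

theorem norm_exp_I_mul (w : ℂ) : ‖Complex.exp (Complex.I * w)‖ = Real.exp (-w.im) := by
  rw [Complex.norm_exp]; simp

/-- The modulus of `e^{iw}` depends only on `Im w`, and monotonically, so the preimage is a
horizontal strip, possibly unbounded or empty. -/
theorem convex_preimage_annulus (a b : ℝ) :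
    Convex ℝ ((fun w : ℂ => Complex.exp (Complex.I * w)) ⁻¹' {z | a < ‖z‖ ∧ ‖z‖ < b}) := by
  have h : (fun w : ℂ => Complex.exp (Complex.I * w)) ⁻¹' {z | a < ‖z‖ ∧ ‖z‖ < b} =
      Complex.imLm ⁻¹' {y : ℝ | a < Real.exp (-y) ∧ Real.exp (-y) < b} := by
    ext w
    simp [norm_exp_I_mul]
  rw [h]
  refine Convex.linear_preimage ?_ _
  refine Set.OrdConnected.convex ⟨fun x hx y hy z hz => ⟨?_, ?_⟩⟩
  · exact hy.1.trans_le (Real.exp_le_exp.2 (by linarith [hz.2]))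
  · exact (Real.exp_le_exp.2 (by linarith [hz.1])).trans_lt hx.2

theorem isOpen_annulus (a b : ℝ) : IsOpen {z : ℂ | a < ‖z‖ ∧ ‖z‖ < b} :=
  (isOpen_lt continuous_const continuous_norm).inter (isOpen_lt continuous_norm continuous_const)

end

theorem mainTheorem9 (M : Set ℂ)
    (hM : M = puncturedPlane ∨ M = puncturedDisk ∨ ∃ r : ℝ, 0 < r ∧ r < 1 ∧ M = openAnnulus r)
    (f : ℂ → CP2) (hf : IsMinimalLagrangianImmersion f M) (hrot : IsRotationallyEquivariant f M) :
    ∃ fExt fTilde : ℂ → CP2,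
      (IsMinimalLagrangianImmersion fExt puncturedPlane ∧
        IsRotationallyEquivariant fExt puncturedPlane ∧
        Set.EqOn fExt f M) ∧
      (IsMinimalLagrangianImmersion fTilde Set.univ ∧
        IsTranslationallyEquivariant fTilde Set.univ ∧
        ∀ w : ℂ, fTilde (w + 2 * Real.pi) = fTilde w) ∧
      ∀ w : ℂ, fExt (Complex.exp (Complex.I * w)) = fTilde w := by
  rcases hM with rfl | rfl | ⟨r, hr0, hr1, rfl⟩
  · refine exists_extension subset_rfl ⟨1, one_ne_zero⟩ isOpen_ne ?_ f hf hrot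
    have : (fun w : ℂ => Complex.exp (Complex.I * w)) ⁻¹' puncturedPlane = Set.univ := by
      ext w
      simp [puncturedPlane]
    rw [this]
    exact convex_univ
  -- The punctured disk is by definition the annulus with radii `0` and `1`, and its preimage is a
  -- half plane.
  · refine exists_extension (fun z hz => norm_pos_iff.1 hz.1) ⟨1 / 2, ?_⟩ (isOpen_annulus 0 1)
      (convex_preimage_annulus 0 1) f hf hrot
    constructor <;> norm_num
  · refine exists_extension (fun z hz => norm_pos_iff.1 (hr0.trans hz.1)) ⟨1, ?_⟩
      (isOpen_annulus r (1 / r)) (convex_preimage_annulus r (1 / r)) f hf hrot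
    refine ⟨by simpa using hr1, ?_⟩
    rw [norm_one, lt_div_iff₀ hr0]
    linarith
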